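/- Let $k$ be any field and let $H$ be a coconnected Hopf algebra over $k$ (not necessarily commutative, cocommutative or finite-dimensional), i.e. every simple $H$-comodule is trivial, that is, isomorphic to $k$ with the coaction $a\mapsto a\otimes 1$. Let $\mathrm{Rep}(H)$ be the category of finite-dimensional $H$-modules over $k$, with tensor product formed through the comultiplication and with unit object $k$, on which $H$ acts through the counit. Let $Gr(\mathrm{Rep}(H))$ be its Grothendieck ring: the free abelian group on the isomorphism classes of finite-dimensional $H$-modules modulo the relations $[V_2]=[V_1]+[V_3]$ for all short exact sequences $0\to V_1\to V_2\to V_3\to 0$, with product $[V][W]=[V\otimes W]$. Let $S$ be the set of all primes not equal to the characteristic of $k$. Then $\mathrm{Rep}(H)$ is virtually indecomposable over $\mathbb{Z}[S^{-1}]$, i.e. the ring $\mathbb{Z}[S^{-1}]\otimes_{\mathbb{Z}}Gr(\mathrm{Rep}(H))$ has no central idempotents other than $0$ and $1$. -/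

import Mathlib

open scoped TensorProduct

universe u v w

/-! ### Comodules and coconnected Hopf algebras -/

/-- A right comodule structure on the `k`-vector space `V` over the coalgebra `H`:
a coassociative and counital `k`-linear map `V → V ⊗ H`. -/
structure RightComodule (k : Type u) (H : Type v) (V : Type w) [Field k] [AddCommGroup H]
    [Module k H] [Coalgebra k H] [AddCommGroup V] [Module k V] where
  coaction : V →ₗ[k] V ⊗[k] H
  coassoc : (TensorProduct.assoc k V H H).toLinearMap ∘ₗ coaction.rTensor H ∘ₗ coaction =
    (Coalgebra.comul (R := k) (A := H)).lTensor V ∘ₗ coaction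
  counit_id : (TensorProduct.rid k V).toLinearMap ∘ₗ
    (Coalgebra.counit (R := k) (A := H)).lTensor V ∘ₗ coaction = LinearMap.id

namespace RightComodule

section
variable {k : Type u} {H : Type v} {V : Type w} [Field k] [AddCommGroup H]
    [Module k H] [Coalgebra k H] [AddCommGroup V] [Module k V]

/-- The subspace `W` is a subcomodule: the coaction maps `W` into `W ⊗ H ⊆ V ⊗ H`. -/
def IsSubcomodule (c : RightComodule k H V) (W : Submodule k V) : Prop :=
  ∀ x ∈ W, c.coaction x ∈ LinearMap.range (W.subtype.rTensor H)

/-- A comodule is simple if it is nonzero and has no subcomodules but `0` and itself. -/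
def IsSimple (c : RightComodule k H V) : Prop :=
  Nontrivial V ∧ ∀ W : Submodule k V, c.IsSubcomodule W → W = ⊥ ∨ W = ⊤

end

/-- A comodule over a Hopf algebra is trivial if it is isomorphic to the unit comodule, that is to
`k` with the coaction `a ↦ a ⊗ 1`. -/
def IsTrivial {k : Type u} {H : Type v} {V : Type w} [Field k] [Ring H] [HopfAlgebra k H]
    [AddCommGroup V] [Module k V] (c : RightComodule k H V) : Prop :=
  ∃ φ : k ≃ₗ[k] V, ∀ a : k, c.coaction (φ a) = φ a ⊗ₜ[k] (1 : H)

end RightComodule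

/-- A Hopf algebra is coconnected if every simple comodule is trivial. (Simple comodules embed into
`H`, so that it is enough to look at comodules in the universe of `H`.) -/
def Coconnected (k : Type u) (H : Type v) [Field k] [Ring H] [HopfAlgebra k H] : Prop :=
  ∀ (V : Type v) [AddCommGroup V] [Module k V] (c : RightComodule k H V),
    c.IsSimple → c.IsTrivial

/-! ### Finite-dimensional modules over a Hopf algebra -/

/-- An object of `Rep(H)`: a finite-dimensional `k`-vector space with an action of `H`. -/
structure HopfRep (k : Type u) (H : Type v) [Field k] [Ring H] [HopfAlgebra k H] where
  carrier : Type u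
  [addCommGroup : AddCommGroup carrier]
  [module : Module k carrier]
  [finite : FiniteDimensional k carrier]
  ρ : H →ₐ[k] Module.End k carrier

namespace HopfRep

attribute [instance] HopfRep.addCommGroup HopfRep.module HopfRep.finite

section
variable {k : Type u} {H : Type v} [Field k] [Ring H] [HopfAlgebra k H]

/-- `H`-linearity of a `k`-linear map between representations. -/
def IsHom (V W : HopfRep k H) (f : V.carrier →ₗ[k] W.carrier) : Prop :=
  ∀ (h : H) (x : V.carrier), f (V.ρ h x) = W.ρ h (f x)

/-- Two representations are isomorphic. -/
def Iso (V W : HopfRep k H) : Prop :=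
  ∃ φ : V.carrier ≃ₗ[k] W.carrier, IsHom V W φ.toLinearMap

/-- There is a short exact sequence `0 → V₁ → V₂ → V₃ → 0` of representations. -/
def ShortExact (V₁ V₂ V₃ : HopfRep k H) : Prop :=
  ∃ (f : V₁.carrier →ₗ[k] V₂.carrier) (g : V₂.carrier →ₗ[k] V₃.carrier),
    IsHom V₁ V₂ f ∧ IsHom V₂ V₃ g ∧
      Function.Injective f ∧ Function.Exact f g ∧ Function.Surjective g

/-- The action of `H ⊗ H` on `V ⊗ W`. -/
noncomputable def outerAction (V W : HopfRep k H) :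
    H ⊗[k] H →ₐ[k] Module.End k (V.carrier ⊗[k] W.carrier) :=
  (Module.endTensorEndAlgHom (R := k) (S := k) (A := k)).comp (Algebra.TensorProduct.map V.ρ W.ρ)

/-- The tensor product of representations: `H` acts on `V ⊗ W` through the comultiplication. -/
noncomputable def tensor (V W : HopfRep k H) : HopfRep k H where
  carrier := V.carrier ⊗[k] W.carrier
  ρ := (outerAction V W).comp (Bialgebra.comulAlgHom k H)

variable (k H) in
/-- The unit representation: `H` acts on `k` through the counit. -/
noncomputable def unit : HopfRep k H where
  carrier := k
  ρ := (Algebra.ofId k (Module.End k k)).comp (Bialgebra.counitAlgHom k H)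

@[simp] lemma outerAction_tmul (V W : HopfRep k H) (a b : H) :
    outerAction V W (a ⊗ₜ b) = TensorProduct.map (V.ρ a) (W.ρ b) := rfl

lemma tensor_ρ (V W : HopfRep k H) (h : H) :
    (tensor V W).ρ h = outerAction V W (Coalgebra.comul (R := k) h) := rfl

lemma unit_ρ (h : H) (a : k) : (unit k H).ρ h a = Coalgebra.counit (R := k) h * a := rfl

lemma Iso.refl (V : HopfRep k H) : Iso V V := ⟨LinearEquiv.refl k _, fun _ _ => rfl⟩

lemma Iso.symm {V W : HopfRep k H} : Iso V W → Iso W V := by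
  rintro ⟨φ, hφ⟩
  refine ⟨φ.symm, fun h x => φ.injective ?_⟩
  have := hφ h (φ.symm x)
  simp only [LinearEquiv.coe_coe, LinearEquiv.apply_symm_apply] at this ⊢
  exact this.symm

lemma Iso.trans {U V W : HopfRep k H} : Iso U V → Iso V W → Iso U W := by
  rintro ⟨φ, hφ⟩ ⟨ψ, hψ⟩
  refine ⟨φ.trans ψ, fun h x => ?_⟩
  have h1 := hφ h x
  have h2 := hψ h (φ x)
  simp only [LinearEquiv.coe_coe, LinearEquiv.trans_apply] at h1 h2 ⊢
  rw [h1, h2]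

lemma IsHom.tensor {V V' W W' : HopfRep k H} {f : V.carrier →ₗ[k] V'.carrier}
    {g : W.carrier →ₗ[k] W'.carrier} (hf : IsHom V V' f) (hg : IsHom W W' g) :
    IsHom (tensor V W) (tensor V' W') (TensorProduct.map f g) := by
  have key : ∀ t : H ⊗[k] H, TensorProduct.map f g ∘ₗ outerAction V W t =
      outerAction V' W' t ∘ₗ TensorProduct.map f g := by
    intro t
    induction t with
    | zero => simp
    | add x y hx hy => simp only [map_add, LinearMap.comp_add, LinearMap.add_comp, hx, hy]
    | tmul a b =>
      ext x y
      simp [hf a x, hg b y]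
  intro h x
  exact LinearMap.congr_fun (key (Coalgebra.comul h)) x

lemma IsHom.id (V : HopfRep k H) : IsHom V V LinearMap.id := fun _ _ => rfl

lemma Iso.tensor {V V' W W' : HopfRep k H} : Iso V V' → Iso W W' →
    Iso (tensor V W) (tensor V' W') := by
  rintro ⟨φ, hφ⟩ ⟨ψ, hψ⟩
  exact ⟨TensorProduct.congr φ ψ, IsHom.tensor hφ hψ⟩

lemma tensor_assoc_iso (U V W : HopfRep k H) :
    Iso (tensor (tensor U V) W) (tensor U (tensor V W)) := by
  have key : ∀ s t : H ⊗[k] H,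
      TensorProduct.assoc k H H H ((Coalgebra.comul (R := k)).rTensor H t) =
        (Coalgebra.comul (R := k)).lTensor H s →
      (TensorProduct.assoc k U.carrier V.carrier W.carrier).toLinearMap ∘ₗ
          outerAction (tensor U V) W t =
        outerAction U (tensor V W) s ∘ₗ
          (TensorProduct.assoc k U.carrier V.carrier W.carrier).toLinearMap := by
    -- the action of `H ⊗ (H ⊗ H)` on `U ⊗ (V ⊗ W)`
    let T : H ⊗[k] (H ⊗[k] H) →ₐ[k] Module.End k (U.carrier ⊗[k] (V.carrier ⊗[k] W.carrier)) :=
      (Module.endTensorEndAlgHom (R := k) (S := k) (A := k)).comp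
        (Algebra.TensorProduct.map U.ρ (outerAction V W))
    have hT : ∀ a b, T (a ⊗ₜ b) = TensorProduct.map (U.ρ a) (outerAction V W b) := fun _ _ => rfl
    have h1 : ∀ s : H ⊗[k] H, outerAction U (tensor V W) s =
        T ((Coalgebra.comul (R := k)).lTensor H s) := by
      intro s
      induction s with
      | zero => simp only [map_zero]; rfl
      | add x y hx hy => simp only [map_add, ← hx, ← hy]; rfl
      | tmul a b => rfl
    have h2 : ∀ (b : H) (r : H ⊗[k] H),
        (TensorProduct.assoc k U.carrier V.carrier W.carrier).toLinearMap ∘ₗ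
          TensorProduct.map (outerAction U V r) (W.ρ b) =
        T (TensorProduct.assoc k H H H (r ⊗ₜ b)) ∘ₗ
          (TensorProduct.assoc k U.carrier V.carrier W.carrier).toLinearMap := by
      intro b r
      induction r with
      | zero => simp
      | add x y hx hy =>
        simp only [map_add, TensorProduct.map_add_left, LinearMap.comp_add, LinearMap.add_comp,
          TensorProduct.add_tmul, hx, hy]
      | tmul a c =>
        ext x y z
        simp [hT]
    have h3 : ∀ t : H ⊗[k] H,
        (TensorProduct.assoc k U.carrier V.carrier W.carrier).toLinearMap ∘ₗ
          outerAction (tensor U V) W t =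
        T (TensorProduct.assoc k H H H ((Coalgebra.comul (R := k)).rTensor H t)) ∘ₗ
          (TensorProduct.assoc k U.carrier V.carrier W.carrier).toLinearMap := by
      intro t
      induction t with
      | zero => simp only [map_zero]; rfl
      | add x y hx hy =>
        simp only [map_add, LinearMap.add_comp, ← hx, ← hy]
        exact LinearMap.comp_add _ _ _
      | tmul a b => exact h2 b (Coalgebra.comul a)
    intro s t hst
    rw [h3, hst, h1]
    rfl
  refine ⟨TensorProduct.assoc k U.carrier V.carrier W.carrier, fun h x => ?_⟩
  exact LinearMap.congr_fun (key (Coalgebra.comul h) (Coalgebra.comul h)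
    (Coalgebra.coassoc_apply h)) x

lemma unit_tensor_iso (V : HopfRep k H) : Iso (tensor (unit k H) V) V := by
  have key : ∀ t : H ⊗[k] H, (TensorProduct.lid k V.carrier).toLinearMap ∘ₗ
      outerAction (unit k H) V t =
      V.ρ (TensorProduct.lid k H ((Coalgebra.counit (R := k)).rTensor H t)) ∘ₗ
        (TensorProduct.lid k V.carrier).toLinearMap := by
    intro t
    induction t with
    | zero => simp only [map_zero]; rfl
    | add x y hx hy =>
      simp only [map_add, LinearMap.add_comp, ← hx, ← hy]
      exact LinearMap.comp_add _ _ _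
    | tmul a b =>
      refine TensorProduct.ext' fun (x : k) y => ?_
      change (Coalgebra.counit (R := k) a * x) • V.ρ b y =
        V.ρ (Coalgebra.counit (R := k) a • b) (x • y)
      simp [mul_smul, smul_comm x]
  refine ⟨TensorProduct.lid k V.carrier, fun h x => ?_⟩
  have := LinearMap.congr_fun (key (Coalgebra.comul h)) x
  rw [Coalgebra.rTensor_counit_comul, TensorProduct.lid_tmul, one_smul] at this
  exact this

lemma tensor_unit_iso (V : HopfRep k H) : Iso (tensor V (unit k H)) V := by
  have key : ∀ t : H ⊗[k] H, (TensorProduct.rid k V.carrier).toLinearMap ∘ₗ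
      outerAction V (unit k H) t =
      V.ρ (TensorProduct.rid k H ((Coalgebra.counit (R := k)).lTensor H t)) ∘ₗ
        (TensorProduct.rid k V.carrier).toLinearMap := by
    intro t
    induction t with
    | zero => simp only [map_zero]; rfl
    | add x y hx hy =>
      simp only [map_add, LinearMap.add_comp, ← hx, ← hy]
      exact LinearMap.comp_add _ _ _
    | tmul a b =>
      refine TensorProduct.ext' fun x (y : k) => ?_
      change (Coalgebra.counit (R := k) b * y) • V.ρ a x =
        V.ρ (Coalgebra.counit (R := k) b • a) (y • x)
      simp [mul_smul, smul_comm y]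
  refine ⟨TensorProduct.rid k V.carrier, fun h x => ?_⟩
  have := LinearMap.congr_fun (key (Coalgebra.comul h)) x
  rw [Coalgebra.lTensor_counit_comul, TensorProduct.rid_tmul, one_smul] at this
  exact this

/-- Tensoring on the left is exact. -/
lemma ShortExact.tensor_left (U : HopfRep k H) {V₁ V₂ V₃ : HopfRep k H} :
    ShortExact V₁ V₂ V₃ → ShortExact (tensor U V₁) (tensor U V₂) (tensor U V₃) := by
  rintro ⟨f, g, hf, hg, hi, he, hs⟩
  exact ⟨f.lTensor U.carrier, g.lTensor U.carrier, IsHom.tensor (IsHom.id U) hf,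
    IsHom.tensor (IsHom.id U) hg, Module.Flat.lTensor_preserves_injective_linearMap _ hi,
    lTensor_exact _ he hs, LinearMap.lTensor_surjective _ hs⟩

/-- Tensoring on the right is exact. -/
lemma ShortExact.tensor_right (U : HopfRep k H) {V₁ V₂ V₃ : HopfRep k H} :
    ShortExact V₁ V₂ V₃ → ShortExact (tensor V₁ U) (tensor V₂ U) (tensor V₃ U) := by
  rintro ⟨f, g, hf, hg, hi, he, hs⟩
  exact ⟨f.rTensor U.carrier, g.rTensor U.carrier, IsHom.tensor hf (IsHom.id U),
    IsHom.tensor hg (IsHom.id U), Module.Flat.rTensor_preserves_injective_linearMap _ hi,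
    rTensor_exact _ he hs, LinearMap.rTensor_surjective _ hs⟩

end

/-! ### The Grothendieck ring of `Rep(H)` -/

section
variable (k : Type u) (H : Type v) [Field k] [Ring H] [HopfAlgebra k H]

/-- Isomorphism of representations as an equivalence relation. -/
instance isoSetoid : Setoid (HopfRep k H) where
  r := Iso
  iseqv := ⟨Iso.refl, Iso.symm, Iso.trans⟩

/-- Isomorphism classes of finite-dimensional representations. -/
def IsoClass : Type (max (u + 1) v) := Quotient (isoSetoid k H)

/-- Isomorphism classes form a monoid under the tensor product. -/
noncomputable instance instMonoidIsoClass : Monoid (IsoClass k H) where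
  mul := Quotient.map₂ tensor fun _ _ h _ _ h' => Iso.tensor h h'
  one := Quotient.mk _ (unit k H)
  mul_assoc := by
    rintro ⟨U⟩ ⟨V⟩ ⟨W⟩
    exact Quotient.sound (tensor_assoc_iso U V W)
  one_mul := by
    rintro ⟨V⟩
    exact Quotient.sound (unit_tensor_iso V)
  mul_one := by
    rintro ⟨V⟩
    exact Quotient.sound (tensor_unit_iso V)

variable {k H} in
/-- The isomorphism class of a representation, as an element of the free abelian group on all
isomorphism classes. With the tensor product of `IsoClass k H` this free abelian group is a ring. -/
def freeClass (V : HopfRep k H) : FreeAbelianGroup (IsoClass k H) :=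
  FreeAbelianGroup.of (Quotient.mk (isoSetoid k H) V)

/-- The subgroup generated by the elements `[V₂] - [V₁] - [V₃]`, one for each short exact sequence
`0 → V₁ → V₂ → V₃ → 0`. -/
noncomputable def exactRelations : AddSubgroup (FreeAbelianGroup (IsoClass k H)) :=
  AddSubgroup.closure {x | ∃ V₁ V₂ V₃ : HopfRep k H, ShortExact V₁ V₂ V₃ ∧
    x = freeClass V₂ - freeClass V₁ - freeClass V₃}

variable {k H}

lemma freeClass_mul (V W : HopfRep k H) :
    freeClass V * freeClass W = freeClass (tensor V W) :=
  (FreeAbelianGroup.of_mul_of _ _)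

lemma exactRelations_mul_left (x : FreeAbelianGroup (IsoClass k H))
    {y : FreeAbelianGroup (IsoClass k H)} (hy : y ∈ exactRelations k H) :
    x * y ∈ exactRelations k H := by
  induction x using FreeAbelianGroup.induction_on with
  | zero => simp
  | neg a ha => rw [neg_mul]; exact neg_mem ha
  | add a b ha hb => rw [add_mul]; exact add_mem ha hb
  | of a =>
    obtain ⟨U, rfl⟩ := Quotient.exists_rep a
    change freeClass U * y ∈ _
    induction hy using AddSubgroup.closure_induction with
    | zero => simp
    | neg a _ ha => rw [mul_neg]; exact neg_mem ha
    | add a b _ _ ha hb => rw [mul_add]; exact add_mem ha hb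
    | mem a ha =>
      obtain ⟨V₁, V₂, V₃, h, rfl⟩ := ha
      simp only [mul_sub, freeClass_mul]
      exact AddSubgroup.subset_closure ⟨_, _, _, h.tensor_left U, rfl⟩

lemma exactRelations_mul_right {x : FreeAbelianGroup (IsoClass k H)}
    (y : FreeAbelianGroup (IsoClass k H)) (hx : x ∈ exactRelations k H) :
    x * y ∈ exactRelations k H := by
  induction y using FreeAbelianGroup.induction_on with
  | zero => simp
  | neg a ha => rw [mul_neg]; exact neg_mem ha
  | add a b ha hb => rw [mul_add]; exact add_mem ha hb
  | of a =>
    obtain ⟨U, rfl⟩ := Quotient.exists_rep a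
    change x * freeClass U ∈ _
    induction hx using AddSubgroup.closure_induction with
    | zero => simp
    | neg a _ ha => rw [neg_mul]; exact neg_mem ha
    | add a b _ _ ha hb => rw [add_mul]; exact add_mem ha hb
    | mem a ha =>
      obtain ⟨V₁, V₂, V₃, h, rfl⟩ := ha
      simp only [sub_mul, freeClass_mul]
      exact AddSubgroup.subset_closure ⟨_, _, _, h.tensor_right U, rfl⟩

variable (k H)

/-- The subgroup of exact relations is a two-sided ideal, because the tensor product is exact. -/
noncomputable def exactIdeal : TwoSidedIdeal (FreeAbelianGroup (IsoClass k H)) :=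
  TwoSidedIdeal.mk' (exactRelations k H) (zero_mem _) add_mem neg_mem
    (fun h => exactRelations_mul_left _ h) (fun h => exactRelations_mul_right _ h)

/-- The Grothendieck ring `Gr(Rep(H))`: the free abelian group on the isomorphism classes of
finite-dimensional `H`-modules modulo the relations `[V₂] = [V₁] + [V₃]` for short exact sequences
`0 → V₁ → V₂ → V₃ → 0`, with the product induced by the tensor product. -/
abbrev GrothendieckRing : Type (max (u + 1) v) := (exactIdeal k H).ringCon.Quotient

/-- `Rep(H)` is virtually indecomposable over `R`: the ring `R ⊗ Gr(Rep(H))` has no central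
idempotents but `0` and `1`. -/
def VirtuallyIndecomposableOver (R : Type w) [CommRing R] : Prop :=
  ∀ e : R ⊗[ℤ] GrothendieckRing k H,
    IsIdempotentElem e → (∀ x, e * x = x * e) → e = 0 ∨ e = 1

end

end HopfRep

/-- `ℤ[S⁻¹]`, where `S` is the set of all primes that differ from the characteristic of `k`. -/
abbrev IntAwayFromChar (k : Type u) [Field k] : Type :=
  Localization (Submonoid.closure {n : ℤ | ∃ q : ℕ, q.Prime ∧ q ≠ ringChar k ∧ n = q})

/-! Write `R = ℤ[S⁻¹]`, let `p` be the characteristic of `k`, possibly `0`, and let `K` be an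
algebraic closure of `k`. Extending scalars to `K` and taking characters sends an idempotent `e` of
`R ⊗ Gr(Rep(H))` to an idempotent `χ` of the convolution algebra of functionals on `K ⊗ H`. Since
`1` is grouplike, `χ(1)` is an idempotent of the field `K`; after passing to `1 - e` if necessary,
`χ(1) = 0`.

Coconnectedness now forces `χ = 0` (`Coconnected.eq_zero_of_convolution_idempotent`). A functional
vanishing at `1` kills every trivial comodule, so on a finite-dimensional comodule, which is an
iterated extension of trivial ones, it acts nilpotently. An idempotent that acts nilpotently acts by
zero, and `H` is the union of its finite-dimensional subcomodules.

Over `K` the characters of non-isomorphic simple modules are linearly independent, and the kernel of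
`R → K` is `pR`. Hence `χ = 0` only says that the image `e_K` of `e` is `p` times some `y`
(`exists_eq_smul_of_charBaseChange_eq_zero`). But then `e_K = e_K ^ n = p ^ n • y ^ n` for all `n ≥
1`.

The descent to `k` uses the algebraic multiplicity of the eigenvalue `1` of an element `h` of `H`.
It is additive, integer-valued and stable under field extension, and as `h` varies it separates the
elements of `R ⊗ Gr(Rep(H))` (`eq_zero_of_multOneBaseChange_eq_zero`). Its values at `e` are
divisible by all powers of `p`, so they vanish by Krull's intersection theorem, and `e = 0`. -/

namespace RightComodule

/-! ### Subcomodules and quotient comodules -/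

section
variable {k : Type u} {H : Type v} {V : Type w} [Field k] [AddCommGroup H]
    [Module k H] [Coalgebra k H] [AddCommGroup V] [Module k V]

/-- The coaction of a subcomodule. -/
noncomputable def restrictCoaction (c : RightComodule k H V) (W : Submodule k V)
    (hW : c.IsSubcomodule W) : W →ₗ[k] W ⊗[k] H :=
  (LinearEquiv.ofInjective (W.subtype.rTensor H)
    (Module.Flat.rTensor_preserves_injective_linearMap _ W.injective_subtype)).symm.toLinearMap ∘ₗ
    (c.coaction ∘ₗ W.subtype).codRestrict _ fun x => hW x x.2

lemma rTensor_subtype_restrictCoaction (c : RightComodule k H V) (W : Submodule k V)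
    (hW : c.IsSubcomodule W) (x : W) :
    W.subtype.rTensor H (c.restrictCoaction W hW x) = c.coaction x := by
  have h := LinearEquiv.ofInjective_symm_apply (f := W.subtype.rTensor H)
    (h := Module.Flat.rTensor_preserves_injective_linearMap _ W.injective_subtype)
    ⟨c.coaction x, hW x x.2⟩
  exact h

/-- A subcomodule is a comodule. -/
noncomputable def restrict (c : RightComodule k H V) (W : Submodule k V)
    (hW : c.IsSubcomodule W) : RightComodule k H W where
  coaction := c.restrictCoaction W hW
  coassoc := by
    have hr : W.subtype.rTensor H ∘ₗ c.restrictCoaction W hW = c.coaction ∘ₗ W.subtype :=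
      LinearMap.ext (c.rTensor_subtype_restrictCoaction W hW)
    ext x
    -- Over a field `W ⊗ (H ⊗ H)` embeds into `V ⊗ (H ⊗ H)`, where the identity is the
    -- coassociativity of `V`.
    apply Module.Flat.rTensor_preserves_injective_linearMap (M := H ⊗[k] H) W.subtype
      W.injective_subtype
    have h1 : ∀ t : W ⊗[k] H, W.subtype.rTensor (H ⊗[k] H)
        (TensorProduct.assoc k W H H ((c.restrictCoaction W hW).rTensor H t)) =
        TensorProduct.assoc k V H H (c.coaction.rTensor H (W.subtype.rTensor H t)) := by
      intro t
      have : ∀ t : (W ⊗[k] H) ⊗[k] H, W.subtype.rTensor (H ⊗[k] H)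
          (TensorProduct.assoc k W H H t) =
          TensorProduct.assoc k V H H ((W.subtype.rTensor H).rTensor H t) := fun t =>
        LinearMap.congr_fun (f := W.subtype.rTensor (H ⊗[k] H) ∘ₗ
          (TensorProduct.assoc k W H H).toLinearMap) (g :=
          (TensorProduct.assoc k V H H).toLinearMap ∘ₗ (W.subtype.rTensor H).rTensor H)
          (by ext; simp) t
      rw [this, ← LinearMap.rTensor_comp_apply, hr, LinearMap.rTensor_comp_apply]
    have h2 : ∀ t : W ⊗[k] H, W.subtype.rTensor (H ⊗[k] H)
        ((Coalgebra.comul (R := k)).lTensor W t) =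
        (Coalgebra.comul (R := k)).lTensor V (W.subtype.rTensor H t) := fun t => by
      simp only [← LinearMap.comp_apply, LinearMap.rTensor_comp_lTensor,
        LinearMap.lTensor_comp_rTensor]
    simp only [LinearMap.comp_apply, LinearEquiv.coe_coe, h1, h2,
      rTensor_subtype_restrictCoaction]
    exact LinearMap.congr_fun c.coassoc x
  counit_id := by
    ext x
    have h1 : ∀ t : W ⊗[k] H, (TensorProduct.rid k W
        ((Coalgebra.counit (R := k)).lTensor W t) : V) =
        TensorProduct.rid k V ((Coalgebra.counit (R := k)).lTensor V (W.subtype.rTensor H t)) :=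
      fun t => LinearMap.congr_fun (f := W.subtype ∘ₗ (TensorProduct.rid k W).toLinearMap ∘ₗ
          (Coalgebra.counit (R := k)).lTensor W) (g := (TensorProduct.rid k V).toLinearMap ∘ₗ
          (Coalgebra.counit (R := k)).lTensor V ∘ₗ W.subtype.rTensor H) (by ext; simp) t
    simp only [LinearMap.comp_apply, LinearEquiv.coe_coe, h1, rTensor_subtype_restrictCoaction]
    exact LinearMap.congr_fun c.counit_id x

/-- The coaction of a quotient comodule. -/
noncomputable def quotientCoaction (c : RightComodule k H V) (W : Submodule k V)
    (hW : c.IsSubcomodule W) : V ⧸ W →ₗ[k] (V ⧸ W) ⊗[k] H :=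
  W.liftQ (W.mkQ.rTensor H ∘ₗ c.coaction) fun x hx => by
    obtain ⟨t, ht⟩ := hW x hx
    rw [LinearMap.mem_ker, LinearMap.comp_apply, ← ht, ← LinearMap.rTensor_comp_apply]
    have : W.mkQ ∘ₗ W.subtype = 0 := by ext; simp
    simp [this]

lemma quotientCoaction_mkQ (c : RightComodule k H V) (W : Submodule k V)
    (hW : c.IsSubcomodule W) (x : V) :
    c.quotientCoaction W hW (W.mkQ x) = W.mkQ.rTensor H (c.coaction x) := rfl

/-- The quotient of a comodule by a subcomodule. -/
noncomputable def quotient (c : RightComodule k H V) (W : Submodule k V)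
    (hW : c.IsSubcomodule W) : RightComodule k H (V ⧸ W) where
  coaction := c.quotientCoaction W hW
  coassoc := by
    have hq : c.quotientCoaction W hW ∘ₗ W.mkQ = W.mkQ.rTensor H ∘ₗ c.coaction := rfl
    refine Submodule.linearMap_qext _ (LinearMap.ext fun x => ?_)
    have h1 : ∀ t : V ⊗[k] H, TensorProduct.assoc k (V ⧸ W) H H
        ((c.quotientCoaction W hW).rTensor H (W.mkQ.rTensor H t)) =
        W.mkQ.rTensor (H ⊗[k] H) (TensorProduct.assoc k V H H (c.coaction.rTensor H t)) := by
      intro t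
      have : ∀ t : (V ⊗[k] H) ⊗[k] H, W.mkQ.rTensor (H ⊗[k] H)
          (TensorProduct.assoc k V H H t) =
          TensorProduct.assoc k (V ⧸ W) H H ((W.mkQ.rTensor H).rTensor H t) := fun t =>
        LinearMap.congr_fun (f := W.mkQ.rTensor (H ⊗[k] H) ∘ₗ
          (TensorProduct.assoc k V H H).toLinearMap) (g :=
          (TensorProduct.assoc k (V ⧸ W) H H).toLinearMap ∘ₗ (W.mkQ.rTensor H).rTensor H)
          (by ext; simp) t
      rw [this, ← LinearMap.rTensor_comp_apply, hq, LinearMap.rTensor_comp_apply]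
    have h2 : ∀ t : V ⊗[k] H, (Coalgebra.comul (R := k)).lTensor (V ⧸ W) (W.mkQ.rTensor H t) =
        W.mkQ.rTensor (H ⊗[k] H) ((Coalgebra.comul (R := k)).lTensor V t) := fun t => by
      simp only [← LinearMap.comp_apply, LinearMap.rTensor_comp_lTensor,
        LinearMap.lTensor_comp_rTensor]
    simp only [LinearMap.comp_apply, LinearEquiv.coe_coe, quotientCoaction_mkQ, h1, h2]
    exact congrArg _ (LinearMap.congr_fun c.coassoc x)
  counit_id := by
    refine Submodule.linearMap_qext _ (LinearMap.ext fun x => ?_)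
    have h1 : ∀ t : V ⊗[k] H, TensorProduct.rid k (V ⧸ W)
        ((Coalgebra.counit (R := k)).lTensor (V ⧸ W) (W.mkQ.rTensor H t)) =
        W.mkQ (TensorProduct.rid k V ((Coalgebra.counit (R := k)).lTensor V t)) :=
      fun t => LinearMap.congr_fun (f := (TensorProduct.rid k (V ⧸ W)).toLinearMap ∘ₗ
          (Coalgebra.counit (R := k)).lTensor (V ⧸ W) ∘ₗ W.mkQ.rTensor H)
          (g := W.mkQ ∘ₗ (TensorProduct.rid k V).toLinearMap ∘ₗ
          (Coalgebra.counit (R := k)).lTensor V) (by ext; simp) t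
    simp only [LinearMap.comp_apply, LinearEquiv.coe_coe, quotientCoaction_mkQ, h1]
    exact congrArg W.mkQ (LinearMap.congr_fun c.counit_id x)

/-- A subcomodule of a subcomodule is a subcomodule. -/
lemma IsSubcomodule.map_subtype {c : RightComodule k H V} {W : Submodule k V}
    (hW : c.IsSubcomodule W) {U : Submodule k W} (hU : (c.restrict W hW).IsSubcomodule U) :
    c.IsSubcomodule (U.map W.subtype) := by
  rintro _ ⟨x, hx, rfl⟩
  obtain ⟨t, ht⟩ := hU x hx
  let i : U →ₗ[k] U.map W.subtype := W.subtype.restrict fun y hy => Submodule.mem_map_of_mem hy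
  refine ⟨i.rTensor H t, ?_⟩
  rw [← LinearMap.rTensor_comp_apply]
  have h : (U.map W.subtype).subtype ∘ₗ i = W.subtype ∘ₗ U.subtype := rfl
  rw [h, LinearMap.rTensor_comp_apply, ht]
  exact c.rTensor_subtype_restrictCoaction W hW x

/-- A nonzero finite-dimensional comodule has a simple subcomodule. -/
lemma exists_isSimple_restrict [FiniteDimensional k V] [Nontrivial V] (c : RightComodule k H V) :
    ∃ (W : Submodule k V) (hW : c.IsSubcomodule W), (c.restrict W hW).IsSimple := by
  have htop : c.IsSubcomodule ⊤ := fun x _ =>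
    LinearMap.rTensor_surjective H (fun y => ⟨⟨y, trivial⟩, rfl⟩) (c.coaction x)
  obtain ⟨W, ⟨hW, hne⟩, hmin⟩ := WellFounded.has_min (wellFounded_lt (α := Submodule k V))
    {W | c.IsSubcomodule W ∧ W ≠ ⊥} ⟨⊤, htop, top_ne_bot⟩
  refine ⟨W, hW, Submodule.nontrivial_iff_ne_bot.2 hne, fun U hU => ?_⟩
  by_contra! hcon
  refine hmin _ ⟨hW.map_subtype hU, fun h => hcon.1 ?_⟩ ?_
  · exact Submodule.map_injective_of_injective W.injective_subtype (h.trans (Submodule.map_bot _).symm)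
  · refine lt_of_le_of_ne (Submodule.map_subtype_le W U) fun h => hcon.2 ?_
    apply Submodule.map_injective_of_injective W.injective_subtype
    rw [h, Submodule.map_subtype_top]

/-! ### Functionals acting on comodules -/

/-- The map `V → V ⊗ A` through which a functional `g : H → A` acts on a comodule `V`. -/
noncomputable def act {A : Type*} [AddCommGroup A] [Module k A] (c : RightComodule k H V)
    (g : H →ₗ[k] A) : V →ₗ[k] V ⊗[k] A :=
  g.lTensor V ∘ₗ c.coaction

/-- By coassociativity, acting twice and multiplying the values in `A` is the action of the
convolution square. So a convolution idempotent acts idempotently. -/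
lemma act_act {A : Type*} [Ring A] [Algebra k A] (c : RightComodule k H V) (g : H →ₗ[k] A)
    (x : V) : (LinearMap.mul' k A).lTensor V (TensorProduct.assoc k V A A
      ((c.act g).rTensor A (c.act g x))) =
    c.act (LinearMap.mul' k A ∘ₗ TensorProduct.map g g ∘ₗ Coalgebra.comul) x := by
  have h : (LinearMap.mul' k A).lTensor V ∘ₗ (TensorProduct.assoc k V A A).toLinearMap ∘ₗ
      TensorProduct.map (g.lTensor V) g =
      (LinearMap.mul' k A ∘ₗ TensorProduct.map g g).lTensor V ∘ₗ
        (TensorProduct.assoc k V H H).toLinearMap := by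
    ext; simp
  have h2 : (c.act g).rTensor A (c.act g x) =
      TensorProduct.map (g.lTensor V) g (c.coaction.rTensor H (c.coaction x)) := by
    have : (c.act g).rTensor A ∘ₗ g.lTensor V =
        TensorProduct.map (g.lTensor V) g ∘ₗ c.coaction.rTensor H := by
      ext; simp [act]
    exact LinearMap.congr_fun this (c.coaction x)
  have h3 := LinearMap.congr_fun c.coassoc x
  simp only [LinearMap.comp_apply, LinearEquiv.coe_coe] at h3
  have h4 := LinearMap.congr_fun h (c.coaction.rTensor H (c.coaction x))
  simp only [LinearMap.comp_apply, LinearEquiv.coe_coe, h3] at h4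
  rw [h2, h4, ← LinearMap.lTensor_comp_apply]
  rfl

end

section
variable {k : Type u} {H : Type v} [Field k] [Ring H] [HopfAlgebra k H]

/-- A convolution idempotent that vanishes at `1` acts by zero on finite-dimensional comodules. -/
lemma act_eq_zero (hH : Coconnected k H) {A : Type*} [Ring A] [Algebra k A] {g : H →ₗ[k] A}
    (hg : LinearMap.mul' k A ∘ₗ TensorProduct.map g g ∘ₗ Coalgebra.comul = g) (hg1 : g 1 = 0)
    (n : ℕ) : ∀ (V : Type v) [AddCommGroup V] [Module k V] [FiniteDimensional k V]
      (c : RightComodule k H V), Module.finrank k V = n → c.act g = 0 := by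
  induction n using Nat.strong_induction_on with
  | _ n ih =>
    intro V _ _ _ c hn
    rcases subsingleton_or_nontrivial V with hV | hV
    · ext x; rw [Subsingleton.elim x 0]; simp
    -- The simple subcomodule `W` is trivial, so `g` acts on it through `g 1 = 0`; the quotient `V ⧸
    -- W` is covered by induction.
    obtain ⟨W, hW, hs⟩ := c.exists_isSimple_restrict
    obtain ⟨φ, hφ⟩ := hH W (c.restrict W hW) hs
    have hWact : ∀ x ∈ W, c.act g x = 0 := by
      intro x hx
      obtain ⟨a, ha⟩ := φ.surjective ⟨x, hx⟩
      have h1 := c.rTensor_subtype_restrictCoaction W hW ⟨x, hx⟩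
      have h2 := hφ a
      rw [ha] at h2
      change c.restrictCoaction W hW _ = _ at h2
      rw [h2] at h1
      change g.lTensor V (c.coaction x) = 0
      rw [← h1]
      simp [hg1]
    have hlt : Module.finrank k (V ⧸ W) < n := by
      have := W.finrank_quotient_add_finrank
      have : 0 < Module.finrank k W := by
        have := hs.1
        exact Module.finrank_pos
      omega
    have hq := ih _ hlt (V ⧸ W) (c.quotient W hW) rfl
    ext x
    -- The action vanishes on `V ⧸ W`, so it maps `V` into `W ⊗ A`.
    have hx : W.mkQ.rTensor A (c.act g x) = 0 := by
      have h1 := LinearMap.congr_fun hq (W.mkQ x)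
      have h2 : ∀ t : V ⊗[k] H, W.mkQ.rTensor A (g.lTensor V t) =
          g.lTensor (V ⧸ W) (W.mkQ.rTensor H t) := fun t => by
        simp only [← LinearMap.comp_apply, LinearMap.rTensor_comp_lTensor,
          LinearMap.lTensor_comp_rTensor]
      exact (h2 _).trans h1
    obtain ⟨t, ht⟩ := (rTensor_exact A (LinearMap.exact_subtype_mkQ W)
      (Submodule.mkQ_surjective W) _).1 hx
    -- Acting a second time gives zero, because the first action lands in `W ⊗ A`; by idempotence
    -- the first action was already zero.
    have h3 := c.act_act g x
    have h4 : c.act g ∘ₗ W.subtype = 0 := LinearMap.ext fun y => hWact y y.2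
    rw [hg, ← ht, ← LinearMap.rTensor_comp_apply, h4] at h3
    rw [← ht, ← h3]
    simp

end

/-! ### Local finiteness of coalgebras and convolution idempotents -/

section
variable {k : Type u} {H : Type v} [Field k] [AddCommGroup H] [Module k H] [Coalgebra k H]

variable (k H) in
/-- A coalgebra as a comodule over itself. -/
noncomputable def regular : RightComodule k H H where
  coaction := Coalgebra.comul
  coassoc := Coalgebra.coassoc
  counit_id := by
    ext x
    simp

/-- Every element of a coalgebra lies in a finite-dimensional subcomodule. -/
lemma exists_finiteDimensional_isSubcomodule (x : H) :
    ∃ W : Submodule k H, x ∈ W ∧ FiniteDimensional k W ∧ (regular k H).IsSubcomodule W := by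
  -- Write `Δ x = ∑ tᵢ ⊗ bᵢ` in a basis `b`. The subcomodule is the span of the finitely many `tᵢ`;
  -- it contains `x = ∑ ε(bᵢ) tᵢ`.
  let b := Module.Free.chooseBasis k H
  obtain ⟨t, ht⟩ := TensorProduct.eq_repr_basis_right b (Coalgebra.comul (R := k) x)
  have hmem : ∀ i ∈ t.support, t i ∈ Submodule.span k (t '' t.support) := fun i hi =>
    Submodule.subset_span ⟨i, hi, rfl⟩
  refine ⟨Submodule.span k (t '' t.support), ?_,
    FiniteDimensional.span_of_finite k (t.support.finite_toSet.image t), fun y hy => ?_⟩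
  · have h := Coalgebra.lTensor_counit_comul (R := k) x
    apply_fun TensorProduct.rid k H at h
    rw [← ht] at h
    simp only [Finsupp.sum, map_sum, LinearMap.lTensor_tmul, TensorProduct.rid_tmul, one_smul]
      at h
    rw [← h]
    exact Submodule.sum_mem _ fun i hi => Submodule.smul_mem _ _ (hmem i hi)
  · refine Submodule.span_le (p := (LinearMap.range
      ((Submodule.span k (t '' t.support)).subtype.rTensor H)).comap (regular k H).coaction).2 ?_ hy
    rintro _ ⟨i, -, rfl⟩
    -- Reading off the coefficient of `bᵢ` in the last tensor factor of the coassociativity identity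
    -- for `x` gives `Δ tᵢ = ∑ tⱼ ⊗ Q (Δ bⱼ)`.
    let Q : H ⊗[k] H →ₗ[k] H := (TensorProduct.rid k H).toLinearMap ∘ₗ (b.coord i).lTensor H
    have hQ : ∀ (y : H ⊗[k] H) (z : H),
        Q.lTensor H (TensorProduct.assoc k H H H (y ⊗ₜ z)) = b.coord i z • y := by
      intro y z
      induction y with
      | zero => simp
      | add y y' h h' => simp only [TensorProduct.add_tmul, map_add, h, h', smul_add]
      | tmul y y' => simp [Q]
    have h := Coalgebra.coassoc_apply (R := k) x
    apply_fun Q.lTensor H at h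
    rw [← ht] at h
    simp only [Finsupp.sum, map_sum, LinearMap.lTensor_tmul, LinearMap.rTensor_tmul, hQ,
      Module.Basis.coord_apply, Module.Basis.repr_self] at h
    have hi : ∑ j ∈ t.support, (Finsupp.single j (1 : k)) i • Coalgebra.comul (R := k) (t j) =
        Coalgebra.comul (R := k) (t i) := by
      rw [Finset.sum_eq_single i]
      · simp
      · intro j _ hj
        simp [Finsupp.single_eq_of_ne' hj]
      · intro hi
        simp [Finsupp.notMem_support_iff.1 hi]
    rw [hi] at h
    change Coalgebra.comul (R := k) (t i) ∈ LinearMap.range _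
    rw [h]
    exact Submodule.sum_mem _ fun j hj =>
      ⟨(⟨t j, hmem j hj⟩ : Submodule.span k _) ⊗ₜ Q (Coalgebra.comul (b j)), rfl⟩

end

end RightComodule

/-- In the convolution algebra of functionals on a coconnected Hopf algebra an idempotent that
vanishes at `1` is zero. -/
lemma Coconnected.eq_zero_of_convolution_idempotent {k : Type u} {H : Type v} [Field k] [Ring H]
    [HopfAlgebra k H] (hH : Coconnected k H) {A : Type*} [Ring A] [Algebra k A] {g : H →ₗ[k] A}
    (hg : LinearMap.mul' k A ∘ₗ TensorProduct.map g g ∘ₗ Coalgebra.comul = g) (hg1 : g 1 = 0) :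
    g = 0 := by
  ext x
  obtain ⟨W, hx, _, hW⟩ := RightComodule.exists_finiteDimensional_isSubcomodule (k := k) x
  have h1 := LinearMap.congr_fun
    (RightComodule.act_eq_zero hH hg hg1 _ W ((RightComodule.regular k H).restrict W hW) rfl)
    ⟨x, hx⟩
  have h2 := RightComodule.rTensor_subtype_restrictCoaction _ W hW ⟨x, hx⟩
  have h3 : g.lTensor H (Coalgebra.comul (R := k) x) = 0 := by
    change g.lTensor H ((RightComodule.regular k H).coaction x) = 0
    rw [← h2, ← LinearMap.comp_apply, LinearMap.lTensor_comp_rTensor,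
      ← LinearMap.rTensor_comp_lTensor, LinearMap.comp_apply]
    refine (congrArg _ h1).trans ?_
    simp
  -- The counit recovers `g` from its action on the regular comodule.
  have h4 : g = (TensorProduct.lid k A).toLinearMap ∘ₗ
      (Coalgebra.counit (R := k)).rTensor A ∘ₗ g.lTensor H ∘ₗ Coalgebra.comul := by
    ext y
    simp only [LinearMap.comp_apply, LinearEquiv.coe_coe]
    rw [← LinearMap.comp_apply, LinearMap.rTensor_comp_lTensor,
      ← LinearMap.lTensor_comp_rTensor, LinearMap.comp_apply, Coalgebra.rTensor_counit_comul]
    simp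
  rw [h4]
  simp only [LinearMap.comp_apply, h3, map_zero, LinearMap.zero_apply]

/-! ### Characteristic polynomials and traces in exact sequences -/

/-- The characteristic polynomial is multiplicative in short exact sequences. -/
lemma LinearMap.charpoly_eq_mul_of_exact {k V₁ V₂ V₃ : Type*} [Field k] [AddCommGroup V₁]
    [Module k V₁] [FiniteDimensional k V₁] [AddCommGroup V₂] [Module k V₂]
    [FiniteDimensional k V₂] [AddCommGroup V₃] [Module k V₃] [FiniteDimensional k V₃]
    {f : V₁ →ₗ[k] V₂} {g : V₂ →ₗ[k] V₃} (hf : Function.Injective f) (he : Function.Exact f g)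
    (hg : Function.Surjective g) {a₁ : V₁ →ₗ[k] V₁} {a₂ : V₂ →ₗ[k] V₂} {a₃ : V₃ →ₗ[k] V₃}
    (h₁ : ∀ x, f (a₁ x) = a₂ (f x)) (h₂ : ∀ x, g (a₂ x) = a₃ (g x)) :
    a₂.charpoly = a₁.charpoly * a₃.charpoly := by
  classical
  -- A linear splitting identifies `V₂` with `V₁ × V₃`, and `a₂` becomes block triangular with
  -- diagonal blocks `a₁` and `a₃`.
  obtain ⟨s, hs⟩ := LinearMap.exists_rightInverse_of_surjective g (LinearMap.range_eq_top.2 hg)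
  have hs' : ∀ y, g (s y) = y := fun y => LinearMap.congr_fun hs y
  have hgf : ∀ x, g (f x) = 0 := fun x => (he _).2 ⟨x, rfl⟩
  have hbij : Function.Bijective (f.coprod s) := by
    constructor
    · rw [injective_iff_map_eq_zero]
      rintro ⟨x, y⟩ hxy
      rw [LinearMap.coprod_apply] at hxy
      have hy : y = 0 := by simpa [hgf, hs'] using congrArg g hxy
      subst hy
      rw [map_zero, add_zero] at hxy
      have hx : x = 0 := hf (hxy.trans (map_zero f).symm)
      rw [hx]
      rfl
    · intro z
      obtain ⟨x, hx⟩ := (he (z - s (g z))).1 (by simp [hs'])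
      exact ⟨(x, g z), by simp [hx]⟩
  let e : (V₁ × V₃) ≃ₗ[k] V₂ := LinearEquiv.ofBijective _ hbij
  have he' : ∀ p, e p = f p.1 + s p.2 := fun p => rfl
  have hge : ∀ z, (e.symm z).2 = g z := by
    intro z
    obtain ⟨p, rfl⟩ := e.surjective z
    rw [LinearEquiv.symm_apply_apply, he', map_add, hgf, hs', zero_add]
  have hef : ∀ x, e.symm (f x) = (x, 0) := fun x => by
    rw [LinearEquiv.symm_apply_eq, he']; simp
  let b₁ := Module.Free.chooseBasis k V₁
  let b₃ := Module.Free.chooseBasis k V₃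
  let a : (V₁ × V₃) →ₗ[k] (V₁ × V₃) := e.symm.conj a₂
  have ha : ∀ p, a p = e.symm (a₂ (e p)) := fun p => by simp [a, LinearEquiv.conj_apply]
  have hM : LinearMap.toMatrix (b₁.prod b₃) (b₁.prod b₃) a =
      Matrix.fromBlocks (LinearMap.toMatrix b₁ b₁ a₁)
        (LinearMap.toMatrix b₃ b₁ (LinearMap.fst k V₁ V₃ ∘ₗ a ∘ₗ LinearMap.inr k V₁ V₃)) 0
        (LinearMap.toMatrix b₃ b₃ a₃) := by
    ext i j
    rcases i with i | i <;> rcases j with j | j <;>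
      simp [LinearMap.toMatrix_apply, ha, he', hge, hs', h₂, ← h₁, hef]
  have hc : a₂.charpoly = a.charpoly := (LinearEquiv.charpoly_conj e.symm a₂).symm
  rw [hc, ← LinearMap.charpoly_toMatrix a (b₁.prod b₃), hM, Matrix.charpoly_fromBlocks_zero₂₁,
    LinearMap.charpoly_toMatrix, LinearMap.charpoly_toMatrix]

/-- Turns multiplicativity of characteristic polynomials into additivity of traces, as `nextCoeff`
is additive on products of monic polynomials. -/
lemma LinearMap.trace_eq_neg_nextCoeff_charpoly {k V : Type*} [Field k] [AddCommGroup V]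
    [Module k V] [FiniteDimensional k V] (a : V →ₗ[k] V) :
    LinearMap.trace k V a = - a.charpoly.nextCoeff := by
  classical
  rw [LinearMap.trace_eq_matrix_trace k (Module.Free.chooseBasis k V),
    Matrix.trace_eq_neg_charpoly_nextCoeff, LinearMap.charpoly_toMatrix]

/-- The trace is additive in short exact sequences. -/
lemma LinearMap.trace_eq_add_of_exact {k V₁ V₂ V₃ : Type*} [Field k] [AddCommGroup V₁]
    [Module k V₁] [FiniteDimensional k V₁] [AddCommGroup V₂] [Module k V₂]
    [FiniteDimensional k V₂] [AddCommGroup V₃] [Module k V₃] [FiniteDimensional k V₃]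
    {f : V₁ →ₗ[k] V₂} {g : V₂ →ₗ[k] V₃} (hf : Function.Injective f) (he : Function.Exact f g)
    (hg : Function.Surjective g) {a₁ : V₁ →ₗ[k] V₁} {a₂ : V₂ →ₗ[k] V₂} {a₃ : V₃ →ₗ[k] V₃}
    (h₁ : ∀ x, f (a₁ x) = a₂ (f x)) (h₂ : ∀ x, g (a₂ x) = a₃ (g x)) :
    LinearMap.trace k V₂ a₂ = LinearMap.trace k V₁ a₁ + LinearMap.trace k V₃ a₃ := by
  rw [a₁.trace_eq_neg_nextCoeff_charpoly, a₂.trace_eq_neg_nextCoeff_charpoly,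
    a₃.trace_eq_neg_nextCoeff_charpoly, LinearMap.charpoly_eq_mul_of_exact hf he hg h₁ h₂,
    a₁.charpoly_monic.nextCoeff_mul a₃.charpoly_monic, neg_add]

/-! ### Homomorphisms out of the Grothendieck ring -/

namespace HopfRep

section
variable {k : Type u} {H : Type v} [Field k] [Ring H] [HopfAlgebra k H]

/-- The class of a representation in the Grothendieck ring. -/
noncomputable def cls (V : HopfRep k H) : GrothendieckRing k H :=
  (exactIdeal k H).ringCon.mk' (freeClass V)

lemma mk'_eq_zero_iff {x : FreeAbelianGroup (IsoClass k H)} :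
    (exactIdeal k H).ringCon.mk' x = 0 ↔ x ∈ exactRelations k H := by
  have h : (exactIdeal k H).ringCon.mk' x = 0 ↔ x ∈ exactIdeal k H := by
    rw [← map_zero (exactIdeal k H).ringCon.mk', TwoSidedIdeal.mem_iff]
    exact RingCon.eq _
  rw [h, exactIdeal, TwoSidedIdeal.mem_mk']
  rfl

lemma ShortExact.cls_eq {V₁ V₂ V₃ : HopfRep k H} (h : ShortExact V₁ V₂ V₃) :
    cls V₂ = cls V₁ + cls V₃ := by
  have h1 : (exactIdeal k H).ringCon.mk' (freeClass V₂ - freeClass V₁ - freeClass V₃) = 0 :=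
    mk'_eq_zero_iff.2 (AddSubgroup.subset_closure ⟨_, _, _, h, rfl⟩)
  rw [map_sub, map_sub, sub_sub, sub_eq_zero] at h1
  exact h1

lemma cls_tensor (V W : HopfRep k H) : cls (tensor V W) = cls V * cls W := by
  rw [cls, ← freeClass_mul, map_mul]
  rfl

lemma cls_unit : cls (unit k H) = 1 := map_one (exactIdeal k H).ringCon.mk'

@[elab_as_elim]
lemma gr_induction {p : GrothendieckRing k H → Prop} (hcls : ∀ V, p (cls V)) (hzero : p 0)
    (hadd : ∀ x y, p x → p y → p (x + y)) (hneg : ∀ x, p x → p (-x))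
    (x : GrothendieckRing k H) : p x := by
  obtain ⟨x, rfl⟩ := RingCon.mk'_surjective (exactIdeal k H).ringCon x
  induction x using FreeAbelianGroup.induction_on with
  | zero => rwa [map_zero]
  | of a =>
    obtain ⟨V, rfl⟩ := Quotient.exists_rep a
    exact hcls V
  | neg a ha => rw [map_neg]; exact hneg _ ha
  | add a b ha hb => rw [map_add]; exact hadd _ _ ha hb

variable (k H) in
/-- The zero representation. -/
noncomputable def zeroRep : HopfRep k H where
  carrier := PUnit
  ρ := ⟨⟨⟨⟨fun _ => 0, Subsingleton.elim _ _⟩, fun _ _ => Subsingleton.elim _ _⟩,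
    Subsingleton.elim _ _, fun _ _ => Subsingleton.elim _ _⟩, fun _ => Subsingleton.elim _ _⟩

lemma Iso.shortExact {V W : HopfRep k H} (h : Iso V W) : ShortExact V W (zeroRep k H) := by
  obtain ⟨φ, hφ⟩ := h
  exact ⟨φ.toLinearMap, 0, hφ, fun _ _ => rfl, φ.injective,
    fun y => ⟨fun _ => φ.surjective y, fun _ => rfl⟩, fun y => ⟨0, rfl⟩⟩

/-- An isomorphism is a short exact sequence whose third term is zero, and additivity on `0 → 0 → 0
→ 0 → 0` kills the zero representation. -/
lemma Iso.eq_of_additive {P : Type*} [AddCommGroup P] {φ : HopfRep k H → P}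
    (hφ : ∀ V₁ V₂ V₃, ShortExact V₁ V₂ V₃ → φ V₂ = φ V₁ + φ V₃) {V W : HopfRep k H}
    (h : Iso V W) : φ V = φ W := by
  have h0 : φ (zeroRep k H) = 0 := by
    simpa using hφ _ _ _ (Iso.refl (zeroRep k H)).shortExact
  rw [hφ _ _ _ h.shortExact, h0, add_zero]

/-- The additive map on the Grothendieck ring given by an additive function on representations. -/
noncomputable def liftAdd {P : Type*} [AddCommGroup P] (φ : HopfRep k H → P)
    (hφ : ∀ V₁ V₂ V₃, ShortExact V₁ V₂ V₃ → φ V₂ = φ V₁ + φ V₃) : GrothendieckRing k H →+ P :=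
  (exactIdeal k H).ringCon.toAddCon.lift
    (FreeAbelianGroup.lift (Quotient.lift φ fun _ _ h => Iso.eq_of_additive hφ h)) (by
      intro x y hxy
      have h : x - y ∈ exactRelations k H := by
        have h' := (TwoSidedIdeal.rel_iff _ _ _).1 hxy
        rw [exactIdeal, TwoSidedIdeal.mem_mk'] at h'
        exact h'
      let F : FreeAbelianGroup (IsoClass k H) →+ P :=
        FreeAbelianGroup.lift (Quotient.lift φ fun _ _ h => Iso.eq_of_additive hφ h)
      have hF : ∀ V, F (freeClass V) = φ V := fun V => FreeAbelianGroup.lift_apply_of _ _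
      have hle : exactRelations k H ≤ F.ker := by
        refine (AddSubgroup.closure_le _).2 ?_
        rintro _ ⟨V₁, V₂, V₃, h, rfl⟩
        change F (freeClass V₂ - freeClass V₁ - freeClass V₃) = 0
        rw [F.map_sub, F.map_sub, hF, hF, hF, hφ _ _ _ h]
        abel
      have h0 : F (x - y) = 0 := hle h
      rw [F.map_sub, sub_eq_zero] at h0
      exact h0)

@[simp] lemma liftAdd_cls {P : Type*} [AddCommGroup P] (φ : HopfRep k H → P)
    (hφ : ∀ V₁ V₂ V₃, ShortExact V₁ V₂ V₃ → φ V₂ = φ V₁ + φ V₃) (V : HopfRep k H) :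
    liftAdd φ hφ (cls V) = φ V := FreeAbelianGroup.lift_apply_of _ _

/-- The ring homomorphism on the Grothendieck ring given by an additive and multiplicative function
on representations. -/
noncomputable def liftRing {P : Type*} [Ring P] (φ : HopfRep k H → P)
    (hφ : ∀ V₁ V₂ V₃, ShortExact V₁ V₂ V₃ → φ V₂ = φ V₁ + φ V₃) (h1 : φ (unit k H) = 1)
    (hmul : ∀ V W, φ (tensor V W) = φ V * φ W) : GrothendieckRing k H →+* P where
  __ := liftAdd φ hφ
  map_one' := by
    change liftAdd φ hφ 1 = 1
    rw [← cls_unit, liftAdd_cls, h1]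
  map_mul' x y := by
    change liftAdd φ hφ (x * y) = liftAdd φ hφ x * liftAdd φ hφ y
    induction x using gr_induction with
    | hzero => simp
    | hadd a b ha hb => rw [add_mul, map_add, map_add, ha, hb, add_mul]
    | hneg a ha => rw [neg_mul, map_neg, map_neg, ha, neg_mul]
    | hcls V =>
      induction y using gr_induction with
      | hzero => simp
      | hadd a b ha hb => rw [mul_add, map_add, map_add, ha, hb, mul_add]
      | hneg a ha => rw [mul_neg, map_neg, map_neg, ha, mul_neg]
      | hcls W => rw [← cls_tensor, liftAdd_cls, liftAdd_cls, liftAdd_cls, hmul]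

@[simp] lemma liftRing_cls {P : Type*} [Ring P] (φ : HopfRep k H → P)
    (hφ : ∀ V₁ V₂ V₃, ShortExact V₁ V₂ V₃ → φ V₂ = φ V₁ + φ V₃) (h1 : φ (unit k H) = 1)
    (hmul : ∀ V W, φ (tensor V W) = φ V * φ W) (V : HopfRep k H) :
    liftRing φ hφ h1 hmul (cls V) = φ V := liftAdd_cls φ hφ V

/-! ### Eigenvalue multiplicities and characters -/

/-- The multiplicity of the eigenvalue `1` of `h`, as an additive map on the Grothendieck ring. -/
noncomputable def multOne (h : H) : GrothendieckRing k H →+ ℤ :=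
  liftAdd (fun V => ((V.ρ h).charpoly.rootMultiplicity 1 : ℤ)) fun V₁ V₂ V₃ hV => by
    obtain ⟨f, g, hf, hg, hi, he, hs⟩ := hV
    rw [LinearMap.charpoly_eq_mul_of_exact hi he hs (hf h) (hg h), Polynomial.rootMultiplicity_mul
      (mul_ne_zero (V₁.ρ h).charpoly_monic.ne_zero (V₃.ρ h).charpoly_monic.ne_zero)]
    push_cast
    rfl

lemma multOne_cls (h : H) (V : HopfRep k H) :
    multOne h (cls V) = ((V.ρ h).charpoly.rootMultiplicity 1 : ℤ) := liftAdd_cls _ _ V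

/-- The character of a representation, in the convolution algebra of functionals on `H`. -/
noncomputable def char (V : HopfRep k H) : WithConv (H →ₗ[k] k) :=
  WithConv.toConv (LinearMap.trace k V.carrier ∘ₗ V.ρ.toLinearMap)

lemma char_tensor (V W : HopfRep k H) : char (tensor V W) = char V * char W := by
  have key : ∀ t : H ⊗[k] H, LinearMap.trace k (V.carrier ⊗[k] W.carrier) (outerAction V W t) =
      LinearMap.mul' k k (TensorProduct.map (char V).ofConv (char W).ofConv t) := by
    intro t
    induction t with
    | zero => simp
    | add x y hx hy => simp only [map_add, hx, hy]
    | tmul a b =>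
      rw [outerAction_tmul, LinearMap.trace_tensorProduct']
      rfl
  ext h
  exact key (Coalgebra.comul h)

lemma char_unit : char (unit k H) = 1 := by
  ext h
  have key : ∀ f : k →ₗ[k] k, LinearMap.trace k k f = f 1 := by
    intro f
    have hf : f = f 1 • LinearMap.id := by ext; simp
    rw [hf]
    simp
  exact (key _).trans ((unit_ρ h 1).trans (mul_one (Coalgebra.counit (R := k) h)))

variable (k H) in
/-- The ring homomorphism from the Grothendieck ring to the convolution algebra of functionals that
takes the class of a representation to its character. -/
noncomputable def charHom : GrothendieckRing k H →+* WithConv (H →ₗ[k] k) :=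
  liftRing char (fun V₁ V₂ V₃ hV => by
    obtain ⟨f, g, hf, hg, hi, he, hs⟩ := hV
    ext h
    exact LinearMap.trace_eq_add_of_exact hi he hs (hf h) (hg h)) char_unit char_tensor

lemma charHom_cls (V : HopfRep k H) : charHom k H (cls V) = char V := liftRing_cls _ _ _ _ V

end

end HopfRep

/-! ### Simple representations and density -/

namespace HopfRep

section
variable {k : Type u} {H : Type v} [Field k] [Ring H] [HopfAlgebra k H]

/-- A representation as a module over the Hopf algebra. -/
instance instModuleCarrier (V : HopfRep k H) : Module H V.carrier :=
  Module.compHom _ V.ρ.toRingHom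

lemma smul_eq (V : HopfRep k H) (h : H) (x : V.carrier) : h • x = V.ρ h x := rfl

instance instIsScalarTowerCarrier (V : HopfRep k H) : IsScalarTower k H V.carrier :=
  ⟨fun a h x => by simp [smul_eq]⟩

/-- A finite-dimensional module over the Hopf algebra as a representation. -/
noncomputable def ofModule (M : Type u) [AddCommGroup M] [Module k M] [Module H M]
    [IsScalarTower k H M] [FiniteDimensional k M] : HopfRep k H where
  carrier := M
  ρ := Algebra.lsmul k k M

/-- A representation is simple if it is a simple module. -/
def IsSimple (V : HopfRep k H) : Prop := IsSimpleModule H V.carrier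

lemma cls_eq_zero (V : HopfRep k H) [Subsingleton V.carrier] : cls V = 0 := by
  have h : ShortExact V V V := ⟨LinearMap.id, LinearMap.id, IsHom.id V, IsHom.id V,
    Function.injective_id, fun y => ⟨fun _ => ⟨y, rfl⟩, fun _ => Subsingleton.elim _ _⟩,
    Function.surjective_id⟩
  simpa using h.cls_eq

/-- The Grothendieck ring is spanned by the classes of the simple representations. -/
lemma cls_mem_closure_simple (n : ℕ) : ∀ V : HopfRep k H, Module.finrank k V.carrier = n →
    cls V ∈ AddSubgroup.closure {x | ∃ S : HopfRep k H, IsSimple S ∧ x = cls S} := by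
  induction n using Nat.strong_induction_on with
  | _ n ih =>
    intro V hn
    rcases subsingleton_or_nontrivial V.carrier with h0 | h0
    · rw [cls_eq_zero]
      exact zero_mem _
    by_cases hV : IsSimple V
    · exact AddSubgroup.subset_closure ⟨V, hV, rfl⟩
    · have : ∃ W : Submodule H V.carrier, W ≠ ⊥ ∧ W ≠ ⊤ := by
        by_contra! hcon
        exact hV (isSimpleModule_iff _ _ |>.2
          { exists_pair_ne := ⟨⊥, ⊤, bot_ne_top⟩
            eq_bot_or_eq_top := fun W => or_iff_not_imp_left.2 (hcon W) })
      obtain ⟨W, hbot, htop⟩ := this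
      let W' : Submodule k V.carrier := W.restrictScalars k
      have : FiniteDimensional k W := inferInstanceAs (FiniteDimensional k W')
      have hfq : FiniteDimensional k (V.carrier ⧸ W) :=
        Module.Finite.of_surjective (W.mkQ.restrictScalars k) W.mkQ_surjective
      have hex : ShortExact (ofModule (k := k) (H := H) W) V (ofModule (V.carrier ⧸ W)) :=
        ⟨W.subtype.restrictScalars k, W.mkQ.restrictScalars k, fun _ _ => rfl, fun _ _ => rfl,
          W.injective_subtype, LinearMap.exact_subtype_mkQ W, W.mkQ_surjective⟩
      have hadd : Module.finrank k (V.carrier ⧸ W) + Module.finrank k W =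
          Module.finrank k V.carrier := W'.finrank_quotient_add_finrank
      have h1 : 0 < Module.finrank k W := by
        have := Submodule.nontrivial_iff_ne_bot.2 hbot
        exact Module.finrank_pos
      have h2 : 0 < Module.finrank k (V.carrier ⧸ W) := by
        have := Submodule.Quotient.nontrivial_iff.2 htop
        exact Module.finrank_pos
      rw [hex.cls_eq]
      exact add_mem (ih (Module.finrank k W) (by omega) (ofModule (k := k) (H := H) W) rfl)
        (ih (Module.finrank k (V.carrier ⧸ W)) (by omega)
          (ofModule (k := k) (H := H) (V.carrier ⧸ W)) rfl)

/-- Equivariant maps between representations are `H`-linear. -/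
def IsHom.toLinear {V W : HopfRep k H} {f : V.carrier →ₗ[k] W.carrier} (hf : IsHom V W f) :
    V.carrier →ₗ[H] W.carrier :=
  { f with map_smul' := hf }

lemma Iso.of_linearEquiv {V W : HopfRep k H} (e : V.carrier ≃ₗ[H] W.carrier) : Iso V W :=
  ⟨e.restrictScalars k, fun h x => e.map_smul h x⟩

lemma Iso.cls_eq {V W : HopfRep k H} (h : Iso V W) : cls V = cls W :=
  Iso.eq_of_additive (fun _ _ _ h => h.cls_eq) h

open scoped Classical in
/-- Density: for finitely many pairwise non-isomorphic simple representations there is an element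
of `H` that acts on one of them as a given map in the bicommutant, and on the others by zero. -/
lemma exists_acts_as {ι : Type*} [Finite ι] (S : ι → HopfRep k H) (hS : ∀ i, IsSimple (S i))
    (hne : Pairwise fun i j => ¬ Iso (S i) (S j)) (i : ι) (f : Module.End k (S i).carrier)
    (hf : ∀ (g : Module.End H (S i).carrier) x, f (g x) = g (f x)) :
    ∃ h : H, (S i).ρ h = f ∧ ∀ j ≠ i, (S j).ρ h = 0 := by
  have := Fintype.ofFinite ι
  have : ∀ i, IsSimpleModule H (S i).carrier := hS
  let M := ∀ i, (S i).carrier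
  have hzero : ∀ (a b : ι) (g : (S a).carrier →ₗ[H] (S b).carrier), a ≠ b → g = 0 := by
    intro a b g hab
    rcases LinearMap.bijective_or_eq_zero g with hg | hg
    · exact absurd (Iso.of_linearEquiv (LinearEquiv.ofBijective g hg)) (hne hab)
    · exact hg
  -- `F` is `f` on the `i`-th summand and zero on the others. By Schur's lemma the endomorphisms of
  -- `M` are diagonal, so `F` commutes with them because `f` does.
  let F : Module.End (Module.End H M) M :=
    { toFun := fun m => Pi.single i (f (m i))
      map_add' := fun m m' => by rw [Pi.add_apply, map_add, Pi.single_add]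
      map_smul' := fun g m => by
        let G : ∀ a b : ι, (S a).carrier →ₗ[H] (S b).carrier := fun a b =>
          LinearMap.proj b ∘ₗ g ∘ₗ LinearMap.single H (fun i => (S i).carrier) a
        have hG : ∀ a b (x : (S a).carrier), g (Pi.single a x) b = G a b x := fun _ _ _ => rfl
        have hgm : (g m) i = G i i (m i) := by
          conv_lhs => rw [← Finset.univ_sum_single m]
          rw [map_sum, Finset.sum_apply, Finset.sum_eq_single i]
          · rfl
          · intro b _ hb
            rw [hG, hzero b i (G b i) hb, LinearMap.zero_apply]
          · simp
        change Pi.single i (f (g m i)) = g (Pi.single i (f (m i)))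
        funext j
        rw [hG, hgm, hf (G i i)]
        rcases eq_or_ne j i with rfl | hj
        · rw [Pi.single_eq_same]
        · rw [Pi.single_eq_of_ne hj, hzero i j (G i j) hj.symm, LinearMap.zero_apply] }
  let b := fun j => Module.Free.chooseBasis k (S j).carrier
  -- Density provides agreement on finitely many vectors only; bases of all the summands suffice.
  obtain ⟨h, hh⟩ := jacobson_density F
    (Finset.univ.image fun p : Σ j, Module.Free.ChooseBasisIndex k (S j).carrier =>
      (Pi.single p.1 (b p.1 p.2) : M))
  have hh' : ∀ j a, F (Pi.single j (b j a)) = h • (Pi.single j (b j a) : M) := fun j a =>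
    hh _ (Finset.mem_image_of_mem (fun p : Σ j, Module.Free.ChooseBasisIndex k (S j).carrier =>
      (Pi.single p.1 (b p.1 p.2) : M)) (Finset.mem_univ ⟨j, a⟩))
  refine ⟨h, (b i).ext fun a => ?_, fun j hj => (b j).ext fun a => ?_⟩
  · have h1 := congrFun (hh' i a) i
    change (Pi.single i (f ((Pi.single i (b i a) : M) i)) : M) i = h • (Pi.single i (b i a) : M) i
      at h1
    rw [Pi.single_eq_same, Pi.single_eq_same] at h1
    exact h1.symm
  · have h1 := congrFun (hh' j a) j
    change (Pi.single i (f ((Pi.single j (b j a) : M) i)) : M) j = h • (Pi.single j (b j a) : M) j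
      at h1
    rw [Pi.single_eq_same, Pi.single_eq_of_ne hj] at h1
    exact h1.symm

variable (k H) in
/-- The isomorphism classes of simple representations. -/
def SimpleClass : Type (max (u + 1) v) := {c : IsoClass k H // IsSimple (Quotient.out c)}

/-- A representative of a class of simple representations. -/
noncomputable def SimpleClass.rep (c : SimpleClass k H) : HopfRep k H := Quotient.out c.1

lemma SimpleClass.rep_not_iso {c d : SimpleClass k H} (h : c ≠ d) : ¬ Iso c.rep d.rep :=
  fun hi => h (Subtype.ext (Quotient.out_equiv_out.1 hi))

lemma IsSimple.of_iso {V W : HopfRep k H} (hV : IsSimple V) (h : Iso V W) : IsSimple W := by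
  obtain ⟨φ, hφ⟩ := h
  have : IsSimpleModule H V.carrier := hV
  let e : V.carrier ≃ₗ[H] W.carrier := { φ with map_smul' := hφ }
  exact IsSimpleModule.congr e.symm

lemma IsSimple.exists_simpleClass {V : HopfRep k H} (hV : IsSimple V) :
    ∃ c : SimpleClass k H, cls V = cls c.rep := by
  have h : Iso V (Quotient.out (Quotient.mk (isoSetoid k H) V)) :=
    Iso.symm (Quotient.mk_out (s := isoSetoid k H) V)
  exact ⟨⟨Quotient.mk _ V, hV.of_iso h⟩, h.cls_eq⟩

/-- Every element of `R ⊗ Gr(Rep(H))` is a combination of classes of simple representations. -/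
lemma exists_finsupp_simpleClass {R : Type w} [CommRing R] (x : R ⊗[ℤ] GrothendieckRing k H) :
    ∃ f : SimpleClass k H →₀ R, x = ∑ c ∈ f.support, f c ⊗ₜ cls c.rep := by
  let Φ : (SimpleClass k H →₀ R) →ₗ[R] R ⊗[ℤ] GrothendieckRing k H :=
    Finsupp.linearCombination R fun c => (1 : R) ⊗ₜ cls c.rep
  have hV : ∀ y : GrothendieckRing k H, (1 : R) ⊗ₜ y ∈ LinearMap.range Φ := by
    intro y
    induction y using gr_induction with
    | hzero => rw [TensorProduct.tmul_zero]; exact zero_mem _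
    | hadd a b ha hb => rw [TensorProduct.tmul_add]; exact add_mem ha hb
    | hneg a ha => rw [TensorProduct.tmul_neg]; exact neg_mem ha
    | hcls V =>
      have h := cls_mem_closure_simple _ V rfl
      generalize cls V = y at h
      induction h using AddSubgroup.closure_induction with
      | zero => rw [TensorProduct.tmul_zero]; exact zero_mem _
      | add a b _ _ ha hb => rw [TensorProduct.tmul_add]; exact add_mem ha hb
      | neg a _ ha => rw [TensorProduct.tmul_neg]; exact neg_mem ha
      | mem a ha =>
        obtain ⟨S, hS, rfl⟩ := ha
        obtain ⟨c, hc⟩ := hS.exists_simpleClass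
        rw [hc]
        exact ⟨Finsupp.single c 1, by simp [Φ]⟩
  have hx : x ∈ LinearMap.range Φ := by
    induction x with
    | zero => exact zero_mem _
    | add a b ha hb => exact add_mem ha hb
    | tmul a y =>
      have : a ⊗ₜ[ℤ] y = a • ((1 : R) ⊗ₜ[ℤ] y) := by rw [TensorProduct.smul_tmul']; simp
      rw [this]
      exact Submodule.smul_mem _ _ (hV y)
  obtain ⟨f, rfl⟩ := hx
  refine ⟨f, ?_⟩
  simp only [Φ, Finsupp.linearCombination_apply, Finsupp.sum, TensorProduct.smul_tmul', smul_eq_mul,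
    mul_one]

/-- The `R`-linear extension of the multiplicity of the eigenvalue `1` of `h`. -/
noncomputable def multOneBaseChange (R : Type w) [CommRing R] (h : H) :
    R ⊗[ℤ] GrothendieckRing k H →ₗ[R] R :=
  (TensorProduct.AlgebraTensorModule.rid ℤ R R).toLinearMap ∘ₗ
    LinearMap.baseChange R (multOne h).toIntLinearMap

lemma multOneBaseChange_tmul {R : Type w} [CommRing R] (h : H) (a : R)
    (x : GrothendieckRing k H) : multOneBaseChange R h (a ⊗ₜ x) = multOne h x • a := rfl

/-- By density some `h` acts as `1` on one simple module of the expansion and as `0` on the others.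
The characteristic polynomials are then `(X - 1) ^ d` and powers of `X`, so what remains is `d`
times one coefficient, and `d` is nonzero in `R`. Traces would see `d` only in `k`, where it may
vanish. -/
lemma eq_zero_of_multOneBaseChange_eq_zero {R : Type w} [CommRing R] [IsDomain R] [CharZero R]
    {x : R ⊗[ℤ] GrothendieckRing k H} (hx : ∀ h : H, multOneBaseChange R h x = 0) : x = 0 := by
  obtain ⟨f, rfl⟩ := exists_finsupp_simpleClass x
  refine Finset.sum_eq_zero fun c hc => ?_
  obtain ⟨h, h1, h2⟩ := exists_acts_as (fun c : f.support => c.1.rep) (fun c => c.1.2)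
    (fun c d hcd => SimpleClass.rep_not_iso fun h => hcd (Subtype.ext h)) ⟨c, hc⟩ 1
    (fun _ _ => rfl)
  have h3 := hx h
  rw [map_sum, Finset.sum_eq_single_of_mem c hc, multOneBaseChange_tmul, multOne_cls, h1,
    LinearMap.charpoly_one] at h3
  · have h4 : Polynomial.rootMultiplicity (1 : k)
        ((Polynomial.X - 1) ^ Module.finrank k c.rep.carrier) =
        Module.finrank k c.rep.carrier := by
      rw [← Polynomial.C_1, Polynomial.rootMultiplicity_X_sub_C_pow]
    rw [h4, zsmul_eq_mul, mul_eq_zero] at h3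
    have : 0 < Module.finrank k c.rep.carrier := by
      have : IsSimpleModule H c.rep.carrier := c.2
      have := IsSimpleModule.nontrivial H c.rep.carrier
      exact Module.finrank_pos
    rcases h3 with h3 | h3
    · exact absurd h3 (by exact_mod_cast this.ne')
    · rw [h3, TensorProduct.zero_tmul]
  · intro d hd hdc
    rw [multOneBaseChange_tmul, multOne_cls, h2 ⟨d, hd⟩ fun h => hdc (congrArg Subtype.val h),
      LinearMap.charpoly_zero, Polynomial.rootMultiplicity_eq_zero]
    · simp
    · simp

end

end HopfRep

/-! ### Characters with coefficients -/

namespace HopfRep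

section
variable {k : Type u} {H : Type v} [Field k] [Ring H] [HopfAlgebra k H]

/-- The character homomorphism on `R ⊗ Gr(Rep(H))`, for a ring homomorphism `R → k`. -/
noncomputable def charBaseChange {R : Type w} [CommRing R] (φ : R →+* k) :
    R ⊗[ℤ] GrothendieckRing k H →+* WithConv (H →ₗ[k] k) :=
  (Algebra.TensorProduct.lift
    ({ (algebraMap k (WithConv (H →ₗ[k] k))).comp φ with
      commutes' := fun n => by
        change ((algebraMap k (WithConv (H →ₗ[k] k))).comp φ) (algebraMap ℤ R n) = _
        rw [eq_intCast, eq_intCast, map_intCast] } : R →ₐ[ℤ] WithConv (H →ₗ[k] k))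
    ({ charHom k H with
      commutes' := fun n => by
        change charHom k H (algebraMap ℤ _ n) = _
        rw [eq_intCast, eq_intCast, map_intCast] } :
        GrothendieckRing k H →ₐ[ℤ] WithConv (H →ₗ[k] k))
    fun a _ => Algebra.commutes (φ a) _).toRingHom

lemma charBaseChange_tmul {R : Type w} [CommRing R] (φ : R →+* k) (a : R) (V : HopfRep k H)
    (h : H) : charBaseChange φ (a ⊗ₜ cls V) h = φ a * LinearMap.trace k V.carrier (V.ρ h) := by
  have h1 : charBaseChange φ (a ⊗ₜ cls V) = algebraMap k (WithConv (H →ₗ[k] k)) (φ a) * char V := by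
    rw [← charHom_cls]
    exact Algebra.TensorProduct.lift_tmul _ _ _ _ _
  rw [h1, ← Algebra.smul_def]
  rfl

/-- Over an algebraically closed field, an element with vanishing character has all its
coefficients in the kernel of `R → k`. -/
lemma exists_eq_smul_of_charBaseChange_eq_zero [IsAlgClosed k] {R : Type w} [CommRing R]
    {φ : R →+* k} {p : R} (hφ : ∀ a, φ a = 0 → p ∣ a) {x : R ⊗[ℤ] GrothendieckRing k H}
    (hx : charBaseChange φ x = 0) : ∃ y, x = p • y := by
  obtain ⟨f, rfl⟩ := exists_finsupp_simpleClass x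
  have hf : ∀ c ∈ f.support, φ (f c) = 0 := by
    intro c hc
    have : IsSimpleModule H c.rep.carrier := c.2
    have := IsSimpleModule.nontrivial H c.rep.carrier
    obtain ⟨v, hv⟩ := exists_ne (0 : c.rep.carrier)
    obtain ⟨ξ, hξ⟩ := Module.Projective.exists_dual_eq_one k hv
    -- Over an algebraically closed field the commutant of a simple module is `k`, so every linear
    -- map is realised by some `h`. The rank-one map `ξ.smulRight v` has trace `ξ v = 1` and thus
    -- isolates the coefficient at `c`.
    obtain ⟨h, h1, h2⟩ := exists_acts_as (fun c : f.support => c.1.rep) (fun c => c.1.2)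
      (fun c d hcd => SimpleClass.rep_not_iso fun h => hcd (Subtype.ext h)) ⟨c, hc⟩
      (ξ.smulRight v) fun g z => by
        obtain ⟨a, rfl⟩ := (IsSimpleModule.algebraMap_end_bijective_of_isAlgClosed k).2 g
        simp [smul_comm a]
    have h3 : charBaseChange φ (∑ c ∈ f.support, f c ⊗ₜ cls c.rep) h = 0 := by rw [hx]; rfl
    have h4 : ∑ c ∈ f.support, φ (f c) * LinearMap.trace k c.rep.carrier (c.rep.ρ h) = 0 := by
      let E : WithConv (H →ₗ[k] k) →+ k :=
        ⟨⟨fun f => f h, rfl⟩, fun _ _ => rfl⟩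
      rw [map_sum] at h3
      refine Eq.trans ?_ h3
      refine Eq.trans ?_ (map_sum E _ _).symm
      exact Finset.sum_congr rfl fun c _ => (charBaseChange_tmul φ (f c) c.rep h).symm
    rw [Finset.sum_eq_single_of_mem c hc] at h4
    · rwa [h1, LinearMap.trace_smulRight, hξ, mul_one] at h4
    · intro d hd hdc
      rw [h2 ⟨d, hd⟩ fun h => hdc (congrArg Subtype.val h), map_zero, mul_zero]
  choose! g hg using fun c hc => hφ _ (hf c hc)
  refine ⟨∑ c ∈ f.support, g c ⊗ₜ cls c.rep, ?_⟩
  rw [Finset.smul_sum]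
  refine Finset.sum_congr rfl fun c hc => ?_
  rw [TensorProduct.smul_tmul', smul_eq_mul, ← hg c hc]

end

/-! ### Extension of the base field -/

section
variable {k : Type u} {H : Type v} [Field k] [Ring H] [HopfAlgebra k H]
variable (K : Type u) [Field K] [Algebra k K]

/-- Extension of the base field of a representation. -/
noncomputable def baseChange (V : HopfRep k H) : HopfRep K (K ⊗[k] H) where
  carrier := K ⊗[k] V.carrier
  ρ := Algebra.TensorProduct.lift (Algebra.ofId K _)
    ((Module.End.baseChangeHom k K V.carrier).comp V.ρ) fun a _ => Algebra.commutes a _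

lemma baseChange_ρ_tmul (V : HopfRep k H) (a : K) (h : H) :
    (baseChange K V).ρ (a ⊗ₜ h) = a • (V.ρ h).baseChange K := by
  change algebraMap K (Module.End K (K ⊗[k] V.carrier)) a * (V.ρ h).baseChange K = _
  rw [← Algebra.smul_def]

lemma comp_baseChange_eq_of_tmul {V : Type*} [AddCommGroup V] [Module k V] {W : Type*}
    [AddCommGroup W] [Module K W] {f : K ⊗[k] V →ₗ[K] W} {a : Module.End k V} {b : Module.End K W}
    (h : ∀ x, f (1 ⊗ₜ a x) = b (f (1 ⊗ₜ x))) : f ∘ₗ a.baseChange K = b ∘ₗ f := by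
  refine LinearMap.ext fun t => ?_
  induction t with
  | zero => simp only [map_zero]
  | add s t hs ht => simp only [map_add, hs, ht]
  | tmul c x =>
    have hc : ∀ y : V, c ⊗ₜ[k] y = c • ((1 : K) ⊗ₜ[k] y) := fun y => by
      rw [TensorProduct.smul_tmul']; simp
    rw [LinearMap.comp_apply, LinearMap.baseChange_tmul, LinearMap.comp_apply, hc, hc, map_smul,
      map_smul, map_smul, h]

/-- By `K`-linearity, equivariance need only be tested for `1 ⊗ h` acting on `1 ⊗ x`. -/
lemma isHom_of_tmul {V : HopfRep k H} {W : HopfRep K (K ⊗[k] H)}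
    {f : (baseChange K V).carrier →ₗ[K] W.carrier}
    (hf : ∀ h (x : V.carrier), f ((1 : K) ⊗ₜ[k] V.ρ h x : K ⊗[k] V.carrier) =
      W.ρ (1 ⊗ₜ h) (f ((1 : K) ⊗ₜ[k] x : K ⊗[k] V.carrier))) : IsHom (baseChange K V) W f := by
  have key : ∀ t, f ∘ₗ (baseChange K V).ρ t = W.ρ t ∘ₗ f := by
    intro t
    induction t with
    | zero => rw [map_zero, map_zero]; ext; simp
    | add s t hs ht => rw [map_add, map_add, LinearMap.comp_add, LinearMap.add_comp, hs, ht]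
    | tmul a h =>
      have h1 : a ⊗ₜ[k] h = a • ((1 : K) ⊗ₜ[k] h) := by rw [TensorProduct.smul_tmul']; simp
      have h2 : f ∘ₗ (baseChange K V).ρ (1 ⊗ₜ h) = W.ρ (1 ⊗ₜ h) ∘ₗ f := by
        rw [baseChange_ρ_tmul, one_smul]
        exact comp_baseChange_eq_of_tmul K (hf h)
      rw [h1, map_smul, map_smul, LinearMap.comp_smul, LinearMap.smul_comp, h2]
  exact fun t x => LinearMap.congr_fun (key t) x

lemma ShortExact.baseChange {V₁ V₂ V₃ : HopfRep k H} (h : ShortExact V₁ V₂ V₃) :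
    ShortExact (baseChange K V₁) (baseChange K V₂) (baseChange K V₃) := by
  obtain ⟨f, g, hf, hg, hi, he, hs⟩ := h
  have key : ∀ {V W : HopfRep k H} {f : V.carrier →ₗ[k] W.carrier}, IsHom V W f →
      IsHom (HopfRep.baseChange K V) (HopfRep.baseChange K W) (f.baseChange K) := by
    intro V W f hf
    refine isHom_of_tmul K fun h x => ?_
    rw [baseChange_ρ_tmul, one_smul]
    exact congrArg (fun y => (1 : K) ⊗ₜ[k] y) (hf h x)
  exact ⟨f.baseChange K, g.baseChange K, key hf, key hg,
    Module.Flat.lTensor_preserves_injective_linearMap f hi, lTensor_exact K he hs,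
    LinearMap.lTensor_surjective K hs⟩

lemma unit_baseChange_iso : Iso (baseChange K (unit k H)) (unit K (K ⊗[k] H)) := by
  refine ⟨TensorProduct.AlgebraTensorModule.rid k K K, isHom_of_tmul K fun h x => ?_⟩
  have key : ∀ y : k, (Coalgebra.counit (R := k) h * y) • (1 : K) =
      (Coalgebra.counit (R := k) h • (1 : K)) * (y • (1 : K)) := fun y => by
    rw [smul_mul_smul_comm, mul_one]
  exact key x

lemma tensor_baseChange_iso (V W : HopfRep k H) :
    Iso (baseChange K (tensor V W)) (tensor (baseChange K V) (baseChange K W)) := by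
  let e := TensorProduct.AlgebraTensorModule.distribBaseChange k K V.carrier W.carrier
  -- The comultiplication of `K ⊗ H` at `1 ⊗ h` is the shuffle of `(1 ⊗ 1) ⊗ Δ h`. An arbitrary `t`
  -- in place of `Δ h` permits induction.
  have key : ∀ t : H ⊗[k] H, ∀ x : V.carrier ⊗[k] W.carrier,
      e (1 ⊗ₜ outerAction V W t x) = outerAction (baseChange K V) (baseChange K W)
        (TensorProduct.AlgebraTensorModule.tensorTensorTensorComm k K k K K K H H
          ((1 ⊗ₜ 1) ⊗ₜ t)) (e (1 ⊗ₜ x)) := by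
    intro t x
    induction t with
    | zero => simp only [map_zero, TensorProduct.tmul_zero, LinearMap.zero_apply]; rfl
    | add s t hs ht =>
      simp only [map_add, LinearMap.add_apply, TensorProduct.tmul_add, hs, ht]
      rfl
    | tmul a b =>
      induction x with
      | zero =>
        simp only [map_zero, TensorProduct.tmul_zero]
        exact (LinearMap.map_zero _).symm
      | add x y hx hy =>
        simp only [map_add, TensorProduct.tmul_add, hx, hy]
        exact (LinearMap.map_add (outerAction (baseChange K V) (baseChange K W) _) _ _).symm
      | tmul x y =>
        rw [TensorProduct.AlgebraTensorModule.tensorTensorTensorComm_tmul, outerAction_tmul,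
          outerAction_tmul, baseChange_ρ_tmul, baseChange_ρ_tmul, one_smul, one_smul]
        rfl
  exact ⟨e, isHom_of_tmul K fun h x => key (Coalgebra.comul h) x⟩

variable (k H) in
/-- Extension of the base field, as a ring homomorphism of Grothendieck rings. -/
noncomputable def baseChangeHom : GrothendieckRing k H →+* GrothendieckRing K (K ⊗[k] H) :=
  liftRing (fun V => cls (baseChange K V)) (fun _ _ _ h => (h.baseChange K).cls_eq)
    ((unit_baseChange_iso K).cls_eq.trans cls_unit)
    fun V W => (tensor_baseChange_iso K V W).cls_eq.trans (cls_tensor _ _)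

/-- The characteristic polynomial commutes with field extension, and root multiplicities do not
change under it. -/
lemma multOne_baseChangeHom (h : H) (x : GrothendieckRing k H) :
    multOne ((1 : K) ⊗ₜ[k] h) (baseChangeHom k H K x) = multOne h x := by
  induction x using gr_induction with
  | hzero => simp
  | hadd a b ha hb => simp only [map_add, ha, hb]
  | hneg a ha => simp only [map_neg, ha]
  | hcls V =>
    rw [baseChangeHom, liftRing_cls, multOne_cls, multOne_cls, baseChange_ρ_tmul, one_smul]
    have h1 := LinearMap.charpoly_baseChange (V.ρ h) K
    have h2 := Polynomial.eq_rootMultiplicity_map (p := (V.ρ h).charpoly)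
      (algebraMap k K).injective 1
    rw [map_one, ← h1] at h2
    exact_mod_cast h2.symm

/-- A convolution idempotent on the extension of a coconnected Hopf algebra that vanishes at `1`
is zero. -/
lemma eq_zero_of_isIdempotentElem (hH : Coconnected k H) {f : WithConv (K ⊗[k] H →ₗ[K] K)}
    (hf : IsIdempotentElem f) (hf1 : f 1 = 0) : f = 0 := by
  -- The restriction of `f` to `H` is a `K`-valued convolution idempotent over `k`. Hence
  -- coconnectedness of `H` itself suffices, and nothing need be known about the comodules of `K ⊗
  -- H`.
  let g : H →ₗ[k] K := f.ofConv.restrictScalars k ∘ₗ TensorProduct.mk k K H 1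
  have key : ∀ t : H ⊗[k] H, LinearMap.mul' K K (TensorProduct.map f.ofConv f.ofConv
      (TensorProduct.AlgebraTensorModule.tensorTensorTensorComm k K k K K K H H
          ((1 ⊗ₜ 1) ⊗ₜ t))) = LinearMap.mul' k K (TensorProduct.map g g t) := by
    intro t
    induction t with
    | zero => simp
    | add s t hs ht => simp only [map_add, TensorProduct.tmul_add, hs, ht]
    | tmul a b => rfl
  have hg : g = 0 := by
    refine hH.eq_zero_of_convolution_idempotent ?_ hf1
    ext h
    refine (key (Coalgebra.comul h)).symm.trans ?_
    exact congrArg (fun f' : WithConv (K ⊗[k] H →ₗ[K] K) => f' ((1 : K) ⊗ₜ h)) hf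
  ext h
  exact LinearMap.congr_fun hg h

end

end HopfRep

/-! ### The coefficient ring `ℤ[S⁻¹]` -/

section
variable (k : Type u) [Field k]

/-- The multiplicative set of integers inverted in `IntAwayFromChar k`. -/
abbrev primesAwayFromChar : Submonoid ℤ :=
  Submonoid.closure {n : ℤ | ∃ q : ℕ, q.Prime ∧ q ≠ ringChar k ∧ n = q}

lemma primesAwayFromChar_le_nonZeroDivisors : primesAwayFromChar k ≤ nonZeroDivisors ℤ :=
  (Submonoid.closure_le).2 fun n hn => by
    obtain ⟨q, hq, -, rfl⟩ := hn
    exact mem_nonZeroDivisors_of_ne_zero (by exact_mod_cast hq.ne_zero)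

instance : IsDomain (IntAwayFromChar k) :=
  IsLocalization.isDomain_localization (primesAwayFromChar_le_nonZeroDivisors k)

instance : CharZero (IntAwayFromChar k) :=
  charZero_of_injective_algebraMap (R := ℤ)
    (IsLocalization.injective (IntAwayFromChar k) (primesAwayFromChar_le_nonZeroDivisors k))

instance : IsNoetherianRing (IntAwayFromChar k) :=
  IsLocalization.isNoetherianRing (primesAwayFromChar k) _ inferInstance

variable (K : Type u) [Field K] [Algebra k K]

lemma isUnit_intCast_of_mem_primesAwayFromChar (n : primesAwayFromChar k) :
    IsUnit (Int.castRingHom K n) := by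
  obtain ⟨n, hn⟩ := n
  change IsUnit (Int.castRingHom K n)
  induction hn using Submonoid.closure_induction with
  | one => simp
  | mul a b _ _ ha hb => rw [map_mul]; exact ha.mul hb
  | mem a ha =>
    obtain ⟨q, hq, hne, rfl⟩ := ha
    have h1 : (q : k) ≠ 0 := fun h0 => hne (by
      have hd := (ringChar.spec k q).1 h0
      rcases CharP.char_is_prime_or_zero k (ringChar k) with hp | hp
      · exact ((Nat.prime_dvd_prime_iff_eq hp hq).1 hd).symm
      · rw [hp, zero_dvd_iff] at hd
        exact absurd hd hq.ne_zero)
    have h2 : (q : K) ≠ 0 := by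
      rw [← map_natCast (algebraMap k K)]
      exact (map_ne_zero _).2 h1
    simpa using h2

/-- The canonical map to an extension of `k`. -/
noncomputable def IntAwayFromChar.toField : IntAwayFromChar k →+* K :=
  IsLocalization.lift (M := primesAwayFromChar k) (isUnit_intCast_of_mem_primesAwayFromChar k K)

/-- A fraction dies in `K` exactly when its numerator does, that is, when the characteristic divides
the numerator. In characteristic zero this is injectivity. -/
lemma IntAwayFromChar.dvd_of_toField_eq_zero {a : IntAwayFromChar k} (ha : toField k K a = 0) :
    (ringChar k : IntAwayFromChar k) ∣ a := by
  obtain ⟨n, s, rfl⟩ := IsLocalization.exists_mk'_eq (primesAwayFromChar k) a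
  have h1 : (Int.castRingHom K) n = 0 := by
    rw [toField, IsLocalization.lift_mk', Units.mul_left_eq_zero] at ha
    exact ha
  have h2 : (n : k) = 0 := by
    apply (algebraMap k K).injective
    rw [map_intCast, map_zero]
    exact h1
  obtain ⟨m, rfl⟩ := (CharP.intCast_eq_zero_iff k (ringChar k) n).1 h2
  refine ⟨IsLocalization.mk' _ m s, ?_⟩
  rw [IsLocalization.mk'_eq_mul_mk'_one, map_mul, mul_assoc, ← IsLocalization.mk'_eq_mul_mk'_one]
  simp

/-- Krull's intersection theorem in a Noetherian domain. The ideal is proper because its generator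
maps to zero in `k`; the zero ideal of characteristic zero is included. -/
lemma IntAwayFromChar.eq_zero_of_forall_pow_dvd {a : IntAwayFromChar k}
    (ha : ∀ n : ℕ, (ringChar k : IntAwayFromChar k) ^ n ∣ a) : a = 0 := by
  have hI : Ideal.span {(ringChar k : IntAwayFromChar k)} ≠ ⊤ := by
    intro h
    have h1 := (Ideal.span_singleton_eq_top.1 h).map (toField k k)
    rw [map_natCast, ringChar.Nat.cast_ringChar] at h1
    exact not_isUnit_zero h1
  have h2 := Ideal.iInf_pow_eq_bot_of_isDomain _ hI
  rw [← Ideal.mem_bot, ← h2, Ideal.mem_iInf]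
  intro n
  rw [Ideal.span_singleton_pow, Ideal.mem_span_singleton]
  exact ha n

end

/-! ### Idempotents in `R ⊗ Gr(Rep(H))` -/

namespace HopfRep

section
variable {k : Type u} {H : Type v} [Field k] [Ring H] [HopfAlgebra k H]

/-- Extension of the base field on `R ⊗ Gr(Rep(H))`. -/
noncomputable def baseChangeAlgHom (R : Type w) [CommRing R] (K : Type u) [Field K] [Algebra k K] :
    R ⊗[ℤ] GrothendieckRing k H →ₐ[R] R ⊗[ℤ] GrothendieckRing K (K ⊗[k] H) :=
  Algebra.TensorProduct.map (AlgHom.id R R)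
    ({ baseChangeHom k H K with
      commutes' := fun n => by
        change baseChangeHom k H K (algebraMap ℤ _ n) = _
        rw [eq_intCast, eq_intCast, map_intCast] } :
        GrothendieckRing k H →ₐ[ℤ] GrothendieckRing K (K ⊗[k] H))

lemma multOneBaseChange_baseChangeAlgHom {R : Type w} [CommRing R] (K : Type u) [Field K]
    [Algebra k K] (h : H) (x : R ⊗[ℤ] GrothendieckRing k H) :
    multOneBaseChange R ((1 : K) ⊗ₜ[k] h) (baseChangeAlgHom R K x) = multOneBaseChange R h x := by
  induction x with
  | zero => simp only [map_zero]
  | add x y hx hy => simp only [map_add, hx, hy]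
  | tmul a x =>
    rw [multOneBaseChange_tmul, ← multOne_baseChangeHom K]
    rfl

variable {R : Type w} [CommRing R] [IsDomain R] [CharZero R] {K : Type u} [Field K] [Algebra k K]
  [IsAlgClosed K] {φ : R →+* K} {p : R}

/-- An idempotent whose character vanishes at `1` is zero. -/
lemma eq_zero_of_isIdempotentElem_of_char_one_eq_zero (hH : Coconnected k H)
    (hφ : ∀ a, φ a = 0 → p ∣ a) (hp : ∀ a, (∀ n : ℕ, p ^ n ∣ a) → a = 0)
    {e : R ⊗[ℤ] GrothendieckRing k H} (he : IsIdempotentElem e)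
    (h1 : charBaseChange φ (baseChangeAlgHom R K e) 1 = 0) : e = 0 := by
  have heK := he.map (baseChangeAlgHom R K)
  obtain ⟨y, hy⟩ := exists_eq_smul_of_charBaseChange_eq_zero hφ
    (eq_zero_of_isIdempotentElem K hH (heK.map (charBaseChange φ)) h1)
  refine eq_zero_of_multOneBaseChange_eq_zero fun h => hp _ fun n => ?_
  -- The exponent is raised to `n + 1` because an idempotent equals its positive powers only.
  refine dvd_trans (pow_dvd_pow _ n.le_succ) ?_
  have h2 : baseChangeAlgHom R K e = p ^ (n + 1) • y ^ (n + 1) := by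
    rw [← smul_pow, ← hy, heK.pow_succ_eq n]
  rw [← multOneBaseChange_baseChangeAlgHom K, h2, map_smul]
  exact Dvd.intro _ rfl

/-- The representation category of a coconnected Hopf algebra is virtually indecomposable over every
domain of characteristic zero that is separated for the kernel of a map to an algebraically closed
extension of the base field. -/
theorem virtuallyIndecomposableOver_of_dvd (hH : Coconnected k H)
    (hφ : ∀ a, φ a = 0 → p ∣ a) (hp : ∀ a, (∀ n : ℕ, p ^ n ∣ a) → a = 0) :
    VirtuallyIndecomposableOver k H R := by
  intro e he _
  let X : R ⊗[ℤ] GrothendieckRing k H →+* WithConv (K ⊗[k] H →ₗ[K] K) :=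
    (charBaseChange φ).comp (baseChangeAlgHom R K).toRingHom
  -- Evaluation at `1` is multiplicative for convolution, since `Δ 1 = 1 ⊗ 1`.
  have h1 : X e 1 * X e 1 = X e 1 := by
    have h2 : (X e * X e) 1 = X e 1 := by rw [← map_mul, he]
    have h3 : (X e * X e) 1 = X e 1 * X e 1 := by
      rw [LinearMap.convMul_apply, Bialgebra.comul_one]
      rfl
    rw [← h3, h2]
  rcases IsIdempotentElem.iff_eq_zero_or_one.1 h1 with h0 | h0
  · exact Or.inl (eq_zero_of_isIdempotentElem_of_char_one_eq_zero hH hφ hp he h0)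
  · have he' : IsIdempotentElem (1 - e) :=
      IsIdempotentElem.one_sub (R := R ⊗[ℤ] GrothendieckRing k H) he
    refine Or.inr (sub_eq_zero.1
      (eq_zero_of_isIdempotentElem_of_char_one_eq_zero hH hφ hp he' ?_)).symm
    change X (1 - e) 1 = 0
    have h2 : X (1 - e) 1 = (1 : WithConv (K ⊗[k] H →ₗ[K] K)) 1 - X e 1 := by
      rw [map_sub X, map_one X]; rfl
    rw [h2, h0, LinearMap.convOne_apply, Bialgebra.counit_one, map_one, sub_self]

end

end HopfRep

theorem mainTheorem11 {k : Type*} {H : Type*} [Field k] [Ring H] [HopfAlgebra k H]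
    (hH : Coconnected k H) :
    HopfRep.VirtuallyIndecomposableOver k H (IntAwayFromChar k) := by
  exact HopfRep.virtuallyIndecomposableOver_of_dvd hH
    (fun _ ha => IntAwayFromChar.dvd_of_toField_eq_zero k (AlgebraicClosure k) ha)
    (fun _ ha => IntAwayFromChar.eq_zero_of_forall_pow_dvd k ha)
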